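/- For a permutation $\sigma$ of a finite set of $N$ points, let the index $\mathrm{ind}(\sigma)$ be $N$ minus the number of disjoint cycles of $\sigma$ (fixed points are counted as cycles of length $1$). For a permutation group $G$ on a finite set, the generator index of $G$ is $$gi(G)=\min_{S\subseteq G,\ \langle S\rangle=G}\ \max_{\sigma\in S}\mathrm{ind}(\sigma)$$ (the maximum over the empty set being $0$). Let $G\le S_N$ be a transitive permutation group of degree $N$ with $gi(G)\le 2$. Then one of the following holds, where in (2)–(4) equality is meant as permutation groups, i.e. up to a relabelling of the points: 1. $G=A_N$ or $G=S_N$ in the natural action of degree $N$. 2. $N=2n$ for some $n$, and $G=C_2\wr S_n$, the imprimitive wreath product of degree $2n$, i.e. the group of all permutations of $\{1,\dots,n\}\times\{1,2\}$ of the form $(i,d)\mapsto(\pi(i),f_i(d))$ with $\pi\in S_n$ and $f_1,\dots,f_n$ permutations of $\{1,2\}$. 3. $N=2n$ for some $n$, and $G=(C_2\wr S_n)\cap A_{2n}$, in the same action of degree $2n$ as in (2). 4. $G$ is one of the following groups in its natural action: the dihedral group $D_5$ of order $10$ on the $N=5$ vertices of the regular pentagon, $PSL_2(5)$ on the $N=6$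 points of the projective line over $\mathbb F_5$, $PSL_3(2)$ on the $N=7$ points of the projective plane over $\mathbb F_2$, or $AGL_3(2)$ on the $N=8$ points of the affine space $\mathbb F_2^3$. -/

import Mathlib

open Equiv

namespace PermGroup

section Index

variable {Ω : Type*} [Fintype Ω] [DecidableEq Ω]

/-- The index of a permutation of a finite set: the number of points minus the number of disjoint
cycles, where every fixed point counts as a cycle of length one. -/
def ind (σ : Perm Ω) : ℕ :=
  Fintype.card Ω - Multiset.card σ.partition.parts

/-- The generator index of a permutation group `G`: the minimum over all generating sets `S` of `G`
of the maximal index of an element of `S`. All permutations of `Ω` form a finite set, so every `S`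
is finite; the maximum over the empty set (which generates the trivial group) is `0`. -/
noncomputable def generatorIndex (G : Subgroup (Perm Ω)) : ℕ :=
  sInf {k : ℕ | ∃ S : Finset (Perm Ω), Subgroup.closure (S : Set (Perm Ω)) = G ∧ S.sup ind = k}

end Index

/-- `G` and `H` are the same permutation group up to a relabelling of the points. -/
def IsPermIso {Ω Ω' : Type*} (G : Subgroup (Perm Ω)) (H : Subgroup (Perm Ω')) : Prop :=
  ∃ e : Ω ≃ Ω', G.map e.permCongrHom.toMonoidHom = H

/-- The imprimitive wreath product of a permutation group `K` on `Δ` and a permutation group `H`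
on `ι`. It acts on `ι × Δ`: the blocks `{i} × Δ` are permuted by an element of `H`, and
the block with label `i` is carried to its image block by an element `f i` of `K`. -/
def wreath {ι Δ : Type*} (K : Subgroup (Perm Δ)) (H : Subgroup (Perm ι)) :
    Subgroup (Perm (ι × Δ)) where
  carrier := {σ | ∃ h ∈ H, ∃ f : ι → Perm Δ, (∀ i, f i ∈ K) ∧ ∀ i d, σ (i, d) = (h i, f i d)}
  one_mem' := ⟨1, H.one_mem, fun _ => 1, fun _ => K.one_mem, fun _ _ => rfl⟩
  mul_mem' := by
    rintro σ τ ⟨h, hh, f, hf, hσ⟩ ⟨h', hh', f', hf', hτ⟩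
    refine ⟨h * h', H.mul_mem hh hh', fun i => f (h' i) * f' i,
      fun i => K.mul_mem (hf _) (hf' _), fun i d => ?_⟩
    simp [Perm.mul_apply, hτ, hσ]
  inv_mem' := by
    rintro σ ⟨h, hh, f, hf, hσ⟩
    refine ⟨h⁻¹, H.inv_mem hh, fun i => (f (h⁻¹ i))⁻¹, fun i => K.inv_mem (hf _),
      fun i d => ?_⟩
    rw [Perm.inv_eq_iff_eq, hσ]
    simp

/-- `C₂ ≀ Sₙ` in its imprimitive action of degree `2n`; the cyclic group of order two in its
action on two points is the group of all permutations of these two points. -/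
def c2WreathSym (n : ℕ) : Subgroup (Perm (Fin n × Fin 2)) :=
  wreath (⊤ : Subgroup (Perm (Fin 2))) (⊤ : Subgroup (Perm (Fin n)))

/-- The action of the dihedral group on the vertices of the regular `n`-gon, labelled cyclically by
`ZMod n`: the rotation `r i` is `x ↦ x + i`, and the reflection `sr i` is `x ↦ -(x + i)`. -/
def dihedralHom (n : ℕ) : DihedralGroup n →* Perm (ZMod n) where
  toFun g := match g with
    | .r i => Equiv.addRight i
    | .sr i => (Equiv.addRight i).trans (Equiv.neg (ZMod n))
  map_one' := Equiv.ext fun x => add_zero x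
  map_mul' := by
    rintro (i | i) (j | j) <;> ext x <;> simp <;> ring

/-- The dihedral group in its natural action of degree `n`. -/
def dihedral (n : ℕ) : Subgroup (Perm (ZMod n)) :=
  (dihedralHom n).range

/-- `PSL_d(K)` in its natural action on the points of the projective space of `K ^ d`. -/
def projSpecialLinear (d : ℕ) (K : Type*) [Field K] :
    Subgroup (Perm (Projectivization K (Fin d → K))) :=
  (Projectivization.PSLAction.toPermHom (ι := Fin d) (K := K)).range

/-- The affine general linear group `AGL_d(K)` (all maps `x ↦ A x + b` with `A` invertible) in
its natural action on the points of the affine space `K ^ d`. -/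
def affineGeneralLinear (d : ℕ) (K : Type*) [Field K] : Subgroup (Perm (Fin d → K)) :=
  MonoidHom.range
    ({ toFun := fun g => g.toEquiv
       map_one' := rfl
       map_mul' := fun _ _ => rfl } :
      ((Fin d → K) ≃ᵃ[K] (Fin d → K)) →* Perm (Fin d → K))

instance fact_prime_five : Fact (Nat.Prime 5) := ⟨by norm_num⟩

end PermGroup

/-! The index of a permutation is the sum of `ℓ - 1` over its cycle lengths `ℓ`, so `G` is generated
by transpositions, 3-cycles and double transpositions.

Suppose `G` is imprimitive. A generator that moves a nontrivial block off itself moves at least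
twice as many points as the block has, so the block is a pair, and `G` commutes with the fixed point
free involution `ι` exchanging the points of each pair. Conjugates and products of the generators
give all even permutations commuting with `ι` (`hasDoubleSwap_of_pairs`, `mem_of_sign_eq_one`).
Hence `G` is the centraliser of `ι`, which is `C₂ ≀ Sₙ`, or its even part.

Suppose `G` is primitive. By Jordan's theorems a transposition or a 3-cycle in `G` leads to `Sₙ` or
`Aₙ`. Otherwise `G` is generated by double transpositions and has no 3-cycle, which restricts how
two supports meet: never in one point, and in exactly three points only if the product is a 5-cycle.
If a 5-cycle arises in this way, five points form a pentagon on which `G` contains `D₅`. A sixth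
point can only be the point at infinity of the projective line over `𝔽₅`, and a seventh is
impossible (`IsPentagon.classification`). If not, distinct supports meet in zero or two points
(`IsQuadSupport.even_meet`), and two supports meeting in two points have a support as symmetric
difference (`HasQuad.symmDiff`): supports behave like affine planes over `𝔽₂`. Primitivity provides
three supports in general position, and these generate the seven planes of `𝔽₂³` that avoid the
origin. At most one more point, the origin, can be added. All transvections are then realised in
`G`, which yields `PSL₃(2)` on seven points and `AGL₃(2)` on eight. -/

namespace PermGroup

/-! ### Calculus of double transpositions and their supports -/

section DoubleSwap

variable {Ω : Type*} [DecidableEq Ω]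

/-- The points `a, b, c, d` are distinct and the double transposition `(a b)(c d)` lies in `G`. -/
def HasDoubleSwap (G : Subgroup (Perm Ω)) (a b c d : Ω) : Prop :=
  (a ≠ b ∧ a ≠ c ∧ a ≠ d ∧ b ≠ c ∧ b ≠ d ∧ c ≠ d) ∧ swap a b * swap c d ∈ G

/-- `G` contains no cycle of length three. -/
def NoThreeCycle (G : Subgroup (Perm Ω)) : Prop :=
  ∀ a b c : Ω, a ≠ b → a ≠ c → b ≠ c → swap a b * swap a c ∉ G

variable {G : Subgroup (Perm Ω)} {a b c d e f g : Ω}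

namespace HasDoubleSwap

theorem left (h : HasDoubleSwap G a b c d) : HasDoubleSwap G b a c d :=
  ⟨by have := h.1; tauto, by rw [swap_comm]; exact h.2⟩

theorem right (h : HasDoubleSwap G a b c d) : HasDoubleSwap G a b d c :=
  ⟨by have := h.1; tauto, by rw [swap_comm d]; exact h.2⟩

theorem mul_comm (h : HasDoubleSwap G a b c d) :
    swap a b * swap c d = swap c d * swap a b := by
  have h2 := h.1
  have h3 : [a, b, c, d].Nodup := by simp; tauto
  exact (Perm.disjoint_swap_swap h3).commute.eq

theorem symm (h : HasDoubleSwap G a b c d) : HasDoubleSwap G c d a b :=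
  ⟨by have := h.1; tauto, h.mul_comm ▸ h.2⟩

theorem apply (h : HasDoubleSwap G a b c d) (x : Ω) :
    (swap a b * swap c d) x =
      if x = a then b else if x = b then a else if x = c then d else if x = d then c else x := by
  have := h.1
  simp only [Perm.mul_apply, swap_apply_def]
  clear h
  grind

theorem conj (h : HasDoubleSwap G a b c d) {σ : Perm Ω} (hσ : σ ∈ G) :
    HasDoubleSwap G (σ a) (σ b) (σ c) (σ d) := by
  refine ⟨by simpa using h.1, ?_⟩
  rw [swap_apply_apply, swap_apply_apply]
  have := G.mul_mem (G.mul_mem hσ h.2) (G.inv_mem hσ)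
  simpa [mul_assoc] using this

theorem map₁ (h : HasDoubleSwap G a b c d) : (swap a b * swap c d) a = b := by
  rw [h.apply, if_pos rfl]

theorem map₂ (h : HasDoubleSwap G a b c d) : (swap a b * swap c d) b = a := by
  rw [h.apply, if_neg h.1.1.symm, if_pos rfl]

theorem map₃ (h : HasDoubleSwap G a b c d) : (swap a b * swap c d) c = d := by
  have := h.1
  rw [h.apply, if_neg (by tauto), if_neg (by tauto), if_pos rfl]

theorem map₄ (h : HasDoubleSwap G a b c d) : (swap a b * swap c d) d = c := by
  have := h.1
  rw [h.apply, if_neg (by tauto), if_neg (by tauto), if_neg (by tauto), if_pos rfl]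

theorem map_ne (h : HasDoubleSwap G a b c d) {x : Ω} (hx : x ≠ a ∧ x ≠ b ∧ x ≠ c ∧ x ≠ d) :
    (swap a b * swap c d) x = x := by
  rw [h.apply, if_neg hx.1, if_neg hx.2.1, if_neg hx.2.2.1, if_neg hx.2.2.2]

/-- The three double transpositions of four points form a Klein four group together with the
identity. -/
theorem mul (h : HasDoubleSwap G a b c d) (h' : HasDoubleSwap G a c b d) :
    HasDoubleSwap G a d b c := by
  have hn := h.1
  have h1 : HasDoubleSwap ⊤ a d b c := ⟨by tauto, trivial⟩
  refine ⟨h1.1, ?_⟩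
  convert G.mul_mem h.2 h'.2 using 1
  ext z
  rw [Perm.mul_apply (swap a b * _)]
  by_cases ha : z = a
  · rw [ha, h'.map₁, h1.map₁, h.map₃]
  by_cases hb : z = b
  · rw [hb, h'.map₃, h1.map₃, h.map₄]
  by_cases hc : z = c
  · rw [hc, h'.map₂, h1.map₄, h.map₁]
  by_cases hd : z = d
  · rw [hd, h'.map₄, h1.map₂, h.map₂]
  rw [h'.map_ne ⟨ha, hc, hb, hd⟩, h.map_ne ⟨ha, hb, hc, hd⟩, h1.map_ne ⟨ha, hd, hb, hc⟩]

theorem cancel (h : HasDoubleSwap G a b c d) (h' : HasDoubleSwap G a b e f)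
    (hn : c ≠ e ∧ c ≠ f ∧ d ≠ e ∧ d ≠ f) : HasDoubleSwap G c d e f := by
  refine ⟨⟨h.1.2.2.2.2.2, hn.1, hn.2.1, hn.2.2.1, hn.2.2.2, h'.1.2.2.2.2.2⟩, ?_⟩
  have := G.mul_mem h.symm.2 h'.2
  rwa [mul_assoc, ← mul_assoc (swap a b), swap_mul_self, one_mul] at this

/-- In the product `(a b)` cancels, leaving `(c d)(c e)`, a 3-cycle unless `d = e`. -/
theorem not_share (hG : NoThreeCycle G)
    (h : HasDoubleSwap G a b c d) (h' : HasDoubleSwap G a b c e) : d = e := by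
  by_contra hde
  have := G.mul_mem h.symm.2 h'.2
  rw [mul_assoc, ← mul_assoc (swap a b), swap_mul_self, one_mul] at this
  have := h.1; have := h'.1
  exact hG c d e (by tauto) (by tauto) (by tauto) ‹_›

/-- Conjugating `(a e)(f g)` by `(a b)(c d)` gives `(b e)(f g)`, and these two violate `not_share`.
-/
theorem not_meet_once (hG : NoThreeCycle G)
    (h : HasDoubleSwap G a b c d) (h' : HasDoubleSwap G a e f g)
    (hn : (e ≠ b ∧ e ≠ c ∧ e ≠ d) ∧ (f ≠ b ∧ f ≠ c ∧ f ≠ d) ∧ (g ≠ b ∧ g ≠ c ∧ g ≠ d)) :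
    False := by
  have h1 := h.1
  have h1' := h'.1
  have h3 := h'.conj h.2
  rw [h.map₁, h.map_ne ⟨h1'.1.symm, hn.1⟩, h.map_ne ⟨h1'.2.1.symm, hn.2.1⟩,
    h.map_ne ⟨h1'.2.2.1.symm, hn.2.2⟩] at h3
  exact h.1.1 (not_share hG h3.symm.right h'.symm.right).symm

end HasDoubleSwap

/-- Some double transposition with support `{a, b, c, d}` lies in `G`. -/
def HasQuad (G : Subgroup (Perm Ω)) (a b c d : Ω) : Prop :=
  HasDoubleSwap G a b c d ∨ HasDoubleSwap G a c b d ∨ HasDoubleSwap G a d b c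

namespace HasQuad

theorem ne (h : HasQuad G a b c d) :
    a ≠ b ∧ a ≠ c ∧ a ≠ d ∧ b ≠ c ∧ b ≠ d ∧ c ≠ d := by
  rcases h with h | h | h <;> have := h.1 <;> tauto

theorem swap12 (h : HasQuad G a b c d) : HasQuad G b a c d := by
  rcases h with h | h | h
  · exact .inl h.left
  · exact .inr (.inr h.symm)
  · exact .inr (.inl h.symm)

theorem swap23 (h : HasQuad G a b c d) : HasQuad G a c b d := by
  rcases h with h | h | h
  · exact .inr (.inl h)
  · exact .inl h
  · exact .inr (.inr h.right)

theorem swap34 (h : HasQuad G a b c d) : HasQuad G a b d c := by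
  rcases h with h | h | h
  · exact .inl h.right
  · exact .inr (.inr h)
  · exact .inr (.inl h)

theorem conj (h : HasQuad G a b c d) {σ : Perm Ω} (hσ : σ ∈ G) :
    HasQuad G (σ a) (σ b) (σ c) (σ d) := by
  rcases h with h | h | h
  · exact .inl (h.conj hσ)
  · exact .inr (.inl (h.conj hσ))
  · exact .inr (.inr (h.conj hσ))

end HasQuad

/-- If the given element on the second support is `(a e)(b f)`, it conjugates `(a b)(c d)` to `(e
f)(c d)`; cancelling `(c d)` leaves `(a b)(e f)`. -/
theorem HasDoubleSwap.transfer (h : HasDoubleSwap G a b c d) (h' : HasQuad G a b e f)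
    (hn : c ≠ e ∧ c ≠ f ∧ d ≠ e ∧ d ≠ f) : HasDoubleSwap G a b e f := by
  have key : ∀ e f, HasDoubleSwap G a e b f → (c ≠ e ∧ c ≠ f ∧ d ≠ e ∧ d ≠ f) →
      HasDoubleSwap G a b e f := by
    intro e f h' hn
    have h1 := h.1
    have h1' := h'.1
    have h4 := h.conj h'.2
    rw [h'.map₁, h'.map₃, h'.map_ne (x := c) (by tauto), h'.map_ne (x := d) (by tauto)] at h4
    exact h.symm.cancel h4.symm (by tauto)
  rcases h' with h' | h' | h'
  · exact h'
  · exact key e f h' hn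
  · exact (key f e h' (by tauto)).right

/-- If `(a b)` occurs on one support, `transfer` makes it occur on both and it cancels. Otherwise
conjugating `(a c)(b d)` by `(a e)(b f)` gives `(e c)(f d)`. -/
theorem HasQuad.symmDiff (h : HasQuad G a b c d) (h' : HasQuad G a b e f)
    (hn : c ≠ e ∧ c ≠ f ∧ d ≠ e ∧ d ≠ f) : HasQuad G c d e f := by
  have key : ∀ c d e f, HasDoubleSwap G a c b d → HasDoubleSwap G a e b f →
      (c ≠ e ∧ c ≠ f ∧ d ≠ e ∧ d ≠ f) → HasQuad G c d e f := by
    intro c d e f h h' hn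
    have h1 := h.1
    have h1' := h'.1
    have h4 := h.conj h'.2
    rw [h'.map₁, h'.map₃, h'.map_ne (x := c) (by tauto), h'.map_ne (x := d) (by tauto)] at h4
    exact .inr (.inl h4.left.right)
  have key2 : HasDoubleSwap G a b c d → HasQuad G c d e f := fun h =>
    .inl (h.cancel (h.transfer h' hn) hn)
  have key3 : HasDoubleSwap G a b e f → HasQuad G c d e f := fun h' =>
    .inl ((h'.transfer h (by tauto)).cancel h' hn)
  rcases h with h | h | h
  · exact key2 h
  · rcases h' with h' | h' | h'
    · exact key3 h'
    · exact key c d e f h h' hn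
    · exact (key c d f e h h' (by tauto)).swap34
  · rcases h' with h' | h' | h'
    · exact key3 h'
    · exact (key d c e f h h' (by tauto)).swap12
    · exact (key d c f e h h' (by tauto)).swap12.swap34

end DoubleSwap
-- Permutations of index at most two
section Generators

variable {Ω : Type*} [Fintype Ω] [DecidableEq Ω]

theorem exists_generating_set {G : Subgroup (Perm Ω)} {k : ℕ} (h : generatorIndex G ≤ k) :
    ∃ S : Set (Perm Ω), Subgroup.closure S = G ∧ ∀ σ ∈ S, ind σ ≤ k := by
  -- The infimum is attained only over a nonempty set (`sInf ∅ = 0` in `ℕ`); `G` generates itself.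
  have hne : {k : ℕ | ∃ S : Finset (Perm Ω),
      Subgroup.closure (S : Set (Perm Ω)) = G ∧ S.sup ind = k}.Nonempty :=
    ⟨_, (Set.toFinite (G : Set (Perm Ω))).toFinset, by simp, rfl⟩
  obtain ⟨S, hS, hk⟩ := Nat.sInf_mem hne
  refine ⟨S, hS, fun σ hσ => ?_⟩
  exact (Finset.le_sup (f := ind) hσ).trans (hk.trans_le h)

theorem ind_eq (σ : Perm Ω) : ind σ = σ.support.card - Multiset.card σ.cycleType := by
  have := σ.support.card_le_univ
  rw [ind, Perm.parts_partition, Multiset.card_add, Multiset.card_replicate]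
  omega

theorem exists_swap_mul_swap {σ : Perm Ω} (h : σ.cycleType = {2, 2}) :
    ∃ a b c d : Ω, (a ≠ b ∧ a ≠ c ∧ a ≠ d ∧ b ≠ c ∧ b ≠ d ∧ c ≠ d) ∧
      σ = swap a b * swap c d := by
  have hsq : ∀ x, σ (σ x) = x := by
    intro x
    have h1 : orderOf σ = 2 := by rw [← Perm.lcm_cycleType, h]; decide
    have h2 := pow_orderOf_eq_one σ
    rw [h1, sq] at h2
    exact Perm.ext_iff.1 h2 x
  have hcard : σ.support.card = 4 := by rw [← Perm.sum_cycleType, h]; decide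
  obtain ⟨a, ha⟩ : ∃ a, a ∈ σ.support := Finset.card_pos.1 (by omega)
  obtain ⟨c, hc, hca⟩ : ∃ c ∈ σ.support, c ∉ ({a, σ a} : Finset Ω) :=
    Finset.exists_mem_notMem_of_card_lt_card (by
      have := Finset.card_le_two (a := a) (b := σ a)
      omega)
  simp only [Finset.mem_insert, Finset.mem_singleton, not_or] at hca
  have ha' := Perm.mem_support.1 ha
  have hc' := Perm.mem_support.1 hc
  have hne : (a ≠ σ a ∧ a ≠ c ∧ a ≠ σ c ∧ σ a ≠ c ∧ σ a ≠ σ c ∧ c ≠ σ c) := by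
    refine ⟨ha'.symm, Ne.symm hca.1, fun h => hca.2 ?_, Ne.symm hca.2, ?_, hc'.symm⟩
    · rw [h, hsq]
    · simpa using Ne.symm hca.1
  have hsupp : σ.support = {a, σ a, c, σ c} := by
    symm
    apply Finset.eq_of_subset_of_card_le
    · intro x hx
      simp only [Finset.mem_insert, Finset.mem_singleton] at hx
      rcases hx with rfl | rfl | rfl | rfl <;> simp_all
    · rw [hcard, Finset.card_insert_of_notMem (by simp; tauto),
        Finset.card_insert_of_notMem (by simp; tauto),
        Finset.card_insert_of_notMem (by simp; tauto), Finset.card_singleton]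
  refine ⟨a, σ a, c, σ c, hne, ?_⟩
  ext x
  by_cases hx : x ∈ σ.support
  · rw [hsupp] at hx
    simp only [Finset.mem_insert, Finset.mem_singleton] at hx
    have key : HasDoubleSwap ⊤ a (σ a) c (σ c) := ⟨hne, trivial⟩
    rcases hx with rfl | rfl | rfl | rfl
    · rw [key.map₁]
    · rw [key.map₂, hsq]
    · rw [key.map₃]
    · rw [key.map₄, hsq]
  · rw [hsupp] at hx
    have h1 : σ x = x := by rw [← Perm.notMem_support, hsupp]; exact hx
    simp only [Finset.mem_insert, Finset.mem_singleton, not_or] at hx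
    have key : HasDoubleSwap ⊤ a (σ a) c (σ c) := ⟨hne, trivial⟩
    rw [h1, key.map_ne hx]

theorem cases_of_ind_le_two {σ : Perm Ω} (h : ind σ ≤ 2) :
    σ = 1 ∨ σ.IsSwap ∨ σ.IsThreeCycle ∨
      ∃ a b c d : Ω, (a ≠ b ∧ a ≠ c ∧ a ≠ d ∧ b ≠ c ∧ b ≠ d ∧ c ≠ d) ∧
        σ = swap a b * swap c d := by
  rw [ind_eq, ← Perm.sum_cycleType] at h
  have h2 : ∀ n ∈ σ.cycleType, 2 ≤ n := fun n => Perm.two_le_of_mem_cycleType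
  -- Nontrivial cycles have length at least two, so the index is at least their number: at most two
  -- of them occur.
  have h3 := Multiset.card_nsmul_le_sum h2
  rw [smul_eq_mul] at h3
  have h4 : Multiset.card σ.cycleType = 0 ∨ Multiset.card σ.cycleType = 1 ∨
      Multiset.card σ.cycleType = 2 := by omega
  rcases h4 with h4 | h4 | h4
  · exact .inl (Perm.card_cycleType_eq_zero.1 h4)
  · obtain ⟨n, hn⟩ := Multiset.card_eq_one.1 h4
    rw [hn] at h h2
    simp only [Multiset.sum_singleton, Multiset.card_singleton, Multiset.mem_singleton,
      forall_eq] at h h2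
    obtain rfl | rfl : n = 2 ∨ n = 3 := by omega
    · exact .inr (.inl (Perm.isSwap_iff_cycleType.2 hn))
    · exact .inr (.inr (.inl hn))
  · obtain ⟨m, n, hn⟩ := Multiset.card_eq_two.1 h4
    rw [hn] at h h2
    simp only [Multiset.insert_eq_cons, Multiset.mem_cons, Multiset.mem_singleton,
      forall_eq_or_imp, forall_eq, Multiset.sum_cons, Multiset.sum_singleton,
      Multiset.card_cons, Multiset.card_singleton] at h h2
    obtain ⟨rfl, rfl⟩ : m = 2 ∧ n = 2 := by omega
    exact .inr (.inr (.inr (exists_swap_mul_swap hn)))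

end Generators

/-! ### Consequences of transitivity and primitivity -/

section Transitive

variable {Ω : Type*} {G : Subgroup (Perm Ω)} {S : Set (Perm Ω)}

/-- An equivalence relation whose classes are preserved by generators contains all pairs of points
in the same orbit. -/
theorem rel_of_mem_closure (hS : Subgroup.closure S = G) (r : Setoid Ω)
    (hr : ∀ σ ∈ S, ∀ x, r x (σ x)) {σ : Perm Ω} (hσ : σ ∈ G) (x : Ω) : r x (σ x) := by
  subst hS
  induction hσ using Subgroup.closure_induction generalizing x with
  | mem σ h => exact hr σ h x
  | one => exact r.refl x
  | mul σ τ _ _ h₁ h₂ => exact r.trans (h₂ x) (h₁ (τ x))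
  | inv σ _ h => simpa using r.symm (h (σ⁻¹ x))

theorem rel_of_isPretransitive (hS : Subgroup.closure S = G) [MulAction.IsPretransitive G Ω]
    (r : Setoid Ω) (hr : ∀ σ ∈ S, ∀ x, r x (σ x)) (x y : Ω) : r x y := by
  obtain ⟨g, rfl⟩ := MulAction.exists_smul_eq G x y
  exact rel_of_mem_closure hS r hr g.2 x

theorem exists_generator_apply_notMem (hS : Subgroup.closure S = G)
    [MulAction.IsPretransitive G Ω] {s : Set Ω} {x y : Ω} (hx : x ∈ s) (hy : y ∉ s) :
    ∃ σ ∈ S, (∃ z ∈ s, σ z ∉ s) ∨ (∃ z ∉ s, σ z ∈ s) := by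
  by_contra! hcon
  -- The two classes of this relation are `s` and its complement.
  have := rel_of_isPretransitive hS (Setoid.comap (· ∈ s) ⊥) (fun σ hσ z => ?_) x y
  · have h1 : (x ∈ s) = (y ∈ s) := this
    exact hy (h1 ▸ hx)
  · change (z ∈ s) = (σ z ∈ s)
    by_cases hz : z ∈ s
    · simp [hz, (hcon σ hσ).1 z hz]
    · simp [hz, (hcon σ hσ).2 z hz]

/-- A primitive group preserves no equivalence relation except the two trivial ones. -/
theorem eq_of_isPreprimitive [MulAction.IsPreprimitive G Ω] (r : Setoid Ω)
    (hr : ∀ σ ∈ G, ∀ x y, r x y → r (σ x) (σ y)) {x y z : Ω} (hxy : r x y) (hxz : ¬ r x z) :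
    x = y := by
  -- A class of an invariant equivalence relation is a block, hence a singleton or everything.
  have hB : MulAction.IsBlock G {w | r x w} := by
    rw [MulAction.isBlock_iff_smul_eq_of_nonempty]
    rintro g ⟨w, ⟨v, hv, hvw⟩, hw⟩
    have hgx : r x (g.1 x) := by
      have h1 : r (g.1 x) (g.1 v) := hr _ g.2 _ _ hv
      have h2 : g.1 v = w := hvw
      rw [h2] at h1
      exact r.trans hw (r.symm h1)
    ext u
    constructor
    · rintro ⟨t, ht, rfl⟩
      exact r.trans hgx (hr _ g.2 _ _ ht)
    · intro hu
      refine ⟨g.1⁻¹ u, ?_, by simp [Subgroup.smul_def]⟩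
      have := hr _ (G.inv_mem g.2) _ _ (r.trans (r.symm hgx) hu)
      simpa using this
  rcases MulAction.IsPreprimitive.isTrivialBlock_of_isBlock hB with h | h
  · exact h (r.refl x) hxy
  · exact absurd (h ▸ Set.mem_univ z : z ∈ {w | r x w}) hxz

variable [DecidableEq Ω]

/-- `G` is generated by double transpositions (and possibly the identity). -/
def IsDoubleSwapGenerated (G : Subgroup (Perm Ω)) : Prop :=
  ∃ S : Set (Perm Ω), Subgroup.closure S = G ∧
    ∀ σ ∈ S, σ = 1 ∨ ∃ a b c d, HasDoubleSwap G a b c d ∧ σ = swap a b * swap c d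

/-- Some generator crosses the boundary of `s`. Being an involution it crosses in both directions,
and the symmetries of `HasDoubleSwap` bring the crossing pair to the front. -/
theorem IsDoubleSwapGenerated.exists_cross (hG : IsDoubleSwapGenerated G)
    [MulAction.IsPretransitive G Ω] {s : Set Ω} {x y : Ω} (hx : x ∈ s) (hy : y ∉ s) :
    ∃ a b c d, HasDoubleSwap G a b c d ∧ a ∈ s ∧ b ∉ s := by
  obtain ⟨S, hS, hS'⟩ := hG
  obtain ⟨σ, hσ, h⟩ := exists_generator_apply_notMem hS hx hy
  rcases hS' σ hσ with rfl | ⟨a, b, c, d, h', rfl⟩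
  · simp only [Perm.one_apply] at h
    tauto
  · obtain ⟨z, h1, h2⟩ | ⟨z, h1, h2⟩ := h
    all_goals
      rw [h'.apply] at h2
      split_ifs at h2 <;> subst_vars
    · exact ⟨_, _, _, _, h', h1, h2⟩
    · exact ⟨_, _, _, _, h'.left, h1, h2⟩
    · exact ⟨_, _, _, _, h'.symm, h1, h2⟩
    · exact ⟨_, _, _, _, h'.symm.left, h1, h2⟩
    · exact absurd h1 h2
    · exact ⟨_, _, _, _, h'.left, h2, h1⟩
    · exact ⟨_, _, _, _, h', h2, h1⟩
    · exact ⟨_, _, _, _, h'.symm.left, h2, h1⟩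
    · exact ⟨_, _, _, _, h'.symm, h2, h1⟩
    · exact absurd h2 h1

theorem IsDoubleSwapGenerated.rel (hG : IsDoubleSwapGenerated G)
    [MulAction.IsPretransitive G Ω] (r : Setoid Ω)
    (hr : ∀ a b c d, HasDoubleSwap G a b c d → r a b) (x y : Ω) : r x y := by
  by_contra hxy
  obtain ⟨a, b, c, d, h, h1, h2⟩ := hG.exists_cross (s := {z | r x z}) (r.refl x) hxy
  exact h2 (r.trans h1 (hr a b c d h))

/-- A subgroup containing all double transpositions of `G` contains `G`. -/
theorem IsDoubleSwapGenerated.le (hG : IsDoubleSwapGenerated G) {H : Subgroup (Perm Ω)}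
    (h : ∀ a b c d, HasDoubleSwap G a b c d → swap a b * swap c d ∈ H) : G ≤ H := by
  obtain ⟨S, hS, hS'⟩ := hG
  rw [← hS, Subgroup.closure_le]
  intro σ hσ
  rcases hS' σ hσ with rfl | ⟨a, b, c, d, h', rfl⟩
  · exact H.one_mem
  · exact h a b c d h'

end Transitive
end PermGroup

namespace PermGroup
open scoped Pointwise

theorem isPermIso_of_mem_iff {Ω Ω' : Type*} {G : Subgroup (Perm Ω)} {H : Subgroup (Perm Ω')}
    (e : Ω ≃ Ω') (h : ∀ σ, σ ∈ G ↔ e.permCongr σ ∈ H) : IsPermIso G H := by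
  refine ⟨e, ?_⟩
  ext τ
  constructor
  · rintro ⟨σ, hσ, rfl⟩
    exact (h σ).1 hσ
  · intro hτ
    have h1 := e.permCongr.apply_symm_apply τ
    exact ⟨e.permCongr.symm τ, (h _).2 (h1.symm ▸ hτ), h1⟩

/-! ### Imprimitive groups: blocks are pairs -/

section FixedPointFreeInvolution

variable {Ω : Type*} [Fintype Ω] [DecidableEq Ω]

theorem card_support_le_four {σ : Perm Ω} (h : ind σ ≤ 2) : σ.support.card ≤ 4 := by
  rw [ind_eq, ← Perm.sum_cycleType] at h
  have h3 := Multiset.card_nsmul_le_sum (s := σ.cycleType) (a := 2)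
    fun n => Perm.two_le_of_mem_cycleType
  rw [smul_eq_mul] at h3
  rw [← Perm.sum_cycleType]
  omega

/-- A group with elements of index at most two as generators is primitive or preserves a partition
of the points into pairs. -/
theorem exists_involutive_of_not_isPreprimitive {G : Subgroup (Perm Ω)} {S : Set (Perm Ω)}
    (hS : Subgroup.closure S = G) (hind : ∀ σ ∈ S, ind σ ≤ 2) [MulAction.IsPretransitive G Ω]
    (hprim : ¬ MulAction.IsPreprimitive G Ω) :
    ∃ ι : Ω → Ω, (∀ x, ι x ≠ x) ∧ (∀ x, ι (ι x) = x) ∧ ∀ g ∈ G, ∀ x, g (ι x) = ι (g x) := by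
  obtain ⟨B, hB, hB'⟩ : ∃ B : Set Ω, MulAction.IsBlock G B ∧ ¬ MulAction.IsTrivialBlock B := by
    by_contra! hcon
    exact hprim ⟨fun {B} hB => hcon B hB⟩
  simp only [MulAction.IsTrivialBlock, not_or, Set.not_subsingleton_iff,
    Set.ne_univ_iff_exists_notMem] at hB'
  obtain ⟨⟨a, ha, a', ha', haa'⟩, c, hc⟩ := hB'
  have hblock : ∀ g ∈ G, ∀ x ∈ B, g x ∈ B → ∀ y, y ∈ B ↔ g y ∈ B := by
    intro g hg x hx hgx y
    have h1 : (⟨g, hg⟩ : G) • B = B := MulAction.isBlock_iff_smul_eq_of_mem.1 hB hx hgx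
    conv_rhs => rw [← h1]
    exact (Set.smul_mem_smul_set_iff (a := (⟨g, hg⟩ : G))).symm
  obtain ⟨σ, hσ, hσB⟩ := exists_generator_apply_notMem hS ha hc
  have hσG : σ ∈ G := hS ▸ Subgroup.subset_closure hσ
  -- The generator does not preserve the block, so it moves it to a disjoint set. The points of `T ⊆
  -- B` and their images are then all moved, which bounds `2|T|` by four.
  have hdisj : ∀ x ∈ B, σ x ∉ B := by
    intro x hx hx'
    have := hblock σ hσG x hx hx'
    rcases hσB with ⟨z, h1, h2⟩ | ⟨z, h1, h2⟩
    · exact h2 ((this z).1 h1)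
    · exact h1 ((this z).2 h2)
  have hcardle : ∀ T : Finset Ω, (∀ x ∈ T, x ∈ B) → 2 * T.card ≤ 4 := by
    intro T hT
    refine le_trans ?_ (card_support_le_four (hind σ hσ))
    have h1 : (T ∪ T.image σ).card = 2 * T.card := by
      rw [Finset.card_union_of_disjoint, Finset.card_image_of_injective _ σ.injective, two_mul]
      rw [Finset.disjoint_left]
      intro x hx hx'
      obtain ⟨y, hy, rfl⟩ := Finset.mem_image.1 hx'
      exact hdisj y (hT y hy) (hT _ hx)
    rw [← h1]
    apply Finset.card_le_card
    intro x hx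
    have hmoved : ∀ x ∈ T, σ x ≠ x := fun x hx h => hdisj x (hT x hx) (h.symm ▸ hT x hx)
    rcases Finset.mem_union.1 hx with hx | hx
    · exact Perm.mem_support.2 (hmoved x hx)
    · obtain ⟨y, hy, rfl⟩ := Finset.mem_image.1 hx
      exact Perm.mem_support.2 fun h => hmoved y hy (σ.injective h)
  have hpair : ∀ z ∈ B, z = a ∨ z = a' := by
    intro z hz
    by_contra! h
    have := hcardle {z, a, a'} (by simp [hz, ha, ha'])
    rw [Finset.card_eq_three.2 ⟨z, a, a', h.1, h.2, haa', rfl⟩] at this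
    omega
  have hfix : ∀ g ∈ G, g a = a → g a' = a' := by
    intro g hg h
    have h1 := (hblock g hg a ha (h.symm ▸ ha) a').1 ha'
    rcases hpair _ h1 with h2 | h2
    · exact absurd (g.injective (h2.trans h.symm)).symm haa'
    · exact h2
  have htrans : ∀ x, ∃ g ∈ G, g a = x := fun x =>
    let ⟨g, hg⟩ := MulAction.exists_smul_eq G a x
    ⟨g.1, g.2, hg⟩
  -- `γ x` carries `a` to `x`, and the partner of `x` is the image of `a'`. By `hfix` it does not
  -- depend on the choice of `γ x`, which gives equivariance.
  choose γ hγG hγ using htrans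
  have hι : ∀ g ∈ G, γ (g a) a' = g a' := by
    intro g hg
    have := hfix (g⁻¹ * γ (g a)) (G.mul_mem (G.inv_mem hg) (hγG _)) (by simp [hγ])
    rw [Perm.mul_apply, Perm.inv_eq_iff_eq] at this
    exact this
  have hcomm : ∀ g ∈ G, ∀ x, g (γ x a') = γ (g x) a' := by
    intro g hg x
    have := hι (g * γ x) (G.mul_mem hg (hγG x))
    simpa [hγ] using this.symm
  refine ⟨fun x => γ x a', fun x h => ?_, fun x => ?_, hcomm⟩
  · exact haa' ((γ x).injective ((hγ x).trans h.symm))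
  · change γ (γ x a') a' = x
    rw [← hcomm _ (hγG x)]
    have h1 : γ a' a' = a := by
      have h2 := (hblock _ (hγG a') a ha ((hγ a').symm ▸ ha') a').1 ha'
      rcases hpair _ h2 with h | h
      · exact h
      · exact absurd ((γ a').injective (h.trans (hγ a').symm)).symm haa'
    rw [h1, hγ]

variable {G : Subgroup (Perm Ω)} {S : Set (Perm Ω)} {ι : Ω → Ω}

/-- Since `σ` commutes with `ι`, its support is closed under `ι`. If `σ` carries `x` to another
pair, the points `x, σ x, ι x, ι (σ x)` fill the whole support; otherwise `σ` flips pairs. -/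
theorem hasDoubleSwap_of_generator (hS : Subgroup.closure S = G) (hind : ∀ σ ∈ S, ind σ ≤ 2)
    (h0 : ∀ x, ι x ≠ x) (h2 : ∀ x, ι (ι x) = x) (hι : ∀ g ∈ G, ∀ x, g (ι x) = ι (g x))
    {σ : Perm Ω} (hσ : σ ∈ S) {x : Ω} (hx : σ x ≠ x) :
    (σ x ≠ ι x ∧ HasDoubleSwap G x (σ x) (ι x) (ι (σ x))) ∨
      (σ x = ι x ∧ (swap x (ι x) ∈ G ∨ ∃ y, HasDoubleSwap G x (ι x) y (ι y))) := by
  have hσG : σ ∈ G := hS ▸ Subgroup.subset_closure hσ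
  have hinj : ∀ x y, ι x = ι y → x = y := fun x y h => by rw [← h2 x, h, h2]
  rcases cases_of_ind_le_two (hind σ hσ) with rfl | h | h | ⟨p, q, r, s, hne, hs⟩
  · exact absurd rfl hx
  · obtain ⟨p, q, hpq, rfl⟩ := h
    have hp := hι _ hσG p
    rw [swap_apply_left] at hp
    have hιp : ι p = q := by
      by_contra hne
      rw [swap_apply_of_ne_of_ne (h0 p) hne] at hp
      exact hpq (hinj _ _ hp)
    have hιq : ι q = p := by rw [← hιp, h2]
    obtain rfl | rfl : x = p ∨ x = q := by
      by_contra! hne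
      exact hx (swap_apply_of_ne_of_ne hne.1 hne.2)
    · exact .inr ⟨by rw [swap_apply_left, hιp], .inl (hιp ▸ hσG)⟩
    · refine .inr ⟨by rw [swap_apply_right, hιq], .inl ?_⟩
      rw [hιq, swap_comm]
      exact hσG
  · have h3 : ∀ y, σ (σ (σ y)) = y := by
      intro y
      have := pow_orderOf_eq_one σ
      rw [h.orderOf] at this
      exact Perm.ext_iff.1 this y
    exfalso
    -- A 3-cycle cannot exchange the points of a pair, so it would move four distinct points.
    have hmoved : ∀ y, σ y ≠ y → σ (σ y) ≠ y := by
      intro y hy hy'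
      have := h3 y
      rw [hy'] at this
      exact hy this
    have hsub : ({x, ι x, σ x, ι (σ x)} : Finset Ω) ⊆ σ.support := by
      intro z hz
      simp only [Finset.mem_insert, Finset.mem_singleton] at hz
      rw [Perm.mem_support]
      rcases hz with rfl | rfl | rfl | rfl
      · exact hx
      · rw [hι _ hσG]
        exact fun h => hx (hinj _ _ h)
      · exact fun h => hx (σ.injective h)
      · rw [hι _ hσG]
        exact fun h => hx (σ.injective (hinj _ _ h))
    have hne : σ x ≠ ι x := by
      intro h
      have h4 := hι _ hσG x
      rw [← h, h] at h4
      rw [h2] at h4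
      exact hmoved x hx (h ▸ h4)
    have h4 := Finset.card_le_card hsub
    rw [h.card_support, Finset.card_insert_of_notMem, Finset.card_insert_of_notMem,
      Finset.card_pair (h0 _).symm] at h4
    · omega
    · simp only [Finset.mem_insert, Finset.mem_singleton, not_or]
      exact ⟨hne.symm, fun h => hx (hinj _ _ h).symm⟩
    · simp only [Finset.mem_insert, Finset.mem_singleton, not_or]
      exact ⟨(h0 x).symm, hx.symm, fun h => hne ((h2 _).symm.trans (congrArg ι h.symm))⟩
  · have key : ∀ p q r s, HasDoubleSwap G p q r s → σ = swap p q * swap r s → x = p →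
        (σ x ≠ ι x ∧ HasDoubleSwap G x (σ x) (ι x) (ι (σ x))) ∨
        (σ x = ι x ∧ (swap x (ι x) ∈ G ∨ ∃ y, HasDoubleSwap G x (ι x) y (ι y))) := by
      rintro p q r s h hσ' rfl
      have hσx : σ x = q := by rw [hσ', h.map₁]
      rw [hσx]
      by_cases hq : q = ι x
      · subst hq
        refine .inr ⟨rfl, .inr ⟨r, ?_⟩⟩
        have hr := hι _ hσG r
        rw [hσ', h.map₃] at hr
        have : ι r = s := by
          by_contra hne
          rw [h.map_ne] at hr
          · exact h.1.2.2.2.2.2 (hinj _ _ hr)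
          · exact ⟨fun h' => h.1.2.2.2.1 (by rw [← h', h2]),
              fun h' => h.1.2.1 (hinj _ _ h').symm, h0 r, hne⟩
        rw [this]
        exact h
      · refine .inl ⟨hq, ?_⟩
        have hx' := hι _ hσG x
        rw [hσx, hσ'] at hx'
        by_cases hr : ι x = r
        · rw [hr, h.map₃] at hx'
          rw [hr, ← hx']
          exact h
        · by_cases hs : ι x = s
          · rw [hs, h.map₄] at hx'
            rw [hs, ← hx']
            exact h.right
          · rw [h.map_ne ⟨h0 x, Ne.symm hq, hr, hs⟩] at hx'
            exact absurd (hinj _ _ hx') h.1.1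
    have hD : HasDoubleSwap G p q r s := ⟨hne, hs ▸ hσG⟩
    by_cases hxp : x = p
    · exact key p q r s hD hs hxp
    by_cases hxq : x = q
    · exact key q p r s hD.left (by rw [hs, swap_comm]) hxq
    have hD' : σ = swap r s * swap p q := hs.trans hD.mul_comm
    by_cases hxr : x = r
    · exact key r s p q hD.symm hD' hxr
    by_cases hxs : x = s
    · exact key s r p q hD.symm.left (by rw [hD', swap_comm]) hxs
    rw [hs, hD.map_ne ⟨hxp, hxq, hxr, hxs⟩] at hx
    exact absurd rfl hx

end FixedPointFreeInvolution
end PermGroup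

namespace PermGroup

/-! ### Imprimitive groups: all even permutations commuting with the involution -/

section Wreath

variable {Ω : Type*} [Fintype Ω] [DecidableEq Ω]
variable {G : Subgroup (Perm Ω)} {S : Set (Perm Ω)} {ι : Ω → Ω}

/-- `G` contains the even permutations of two pairs that preserve each or exchange them. -/
theorem hasDoubleSwap_of_pairs [MulAction.IsPretransitive G Ω]
    (hS : Subgroup.closure S = G) (hind : ∀ σ ∈ S, ind σ ≤ 2)
    (h0 : ∀ x, ι x ≠ x) (h2 : ∀ x, ι (ι x) = x) (hι : ∀ g ∈ G, ∀ x, g (ι x) = ι (g x))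
    {x y : Ω} (hxy : y ≠ x) (hxy' : y ≠ ι x) :
    HasDoubleSwap G x y (ι x) (ι y) ∧ HasDoubleSwap G x (ι x) y (ι y) := by
  have hinj : ∀ x y, ι x = ι y → x = y := fun x y h => by rw [← h2 x, h, h2]
  have hsymm : ∀ x y, HasDoubleSwap G x y (ι x) (ι y) → HasDoubleSwap G y x (ι y) (ι x) :=
    fun x y h => h.left.right
  have hswap : ∀ x y, HasDoubleSwap G (ι x) y (ι (ι x)) (ι y) →
      HasDoubleSwap G x (ι y) (ι x) (ι (ι y)) := by
    intro x y h
    rw [h2] at h ⊢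
    exact h.symm
  -- Conjugate `(x y)(ιx ιy)` by `(y z)(ιy ιz)`.
  have htrans : ∀ x y z, HasDoubleSwap G x y (ι x) (ι y) → HasDoubleSwap G y z (ι y) (ι z) →
      x ≠ z → x ≠ ι z → HasDoubleSwap G x z (ι x) (ι z) := by
    intro x y z hxy hyz h3 h4
    have h5 := hxy.1
    have h6 := hyz.1
    have h7 := hxy.conj hyz.2
    have h8 : y ≠ ι x := fun h => hxy.1.2.2.2.1 h
    rwa [hyz.map_ne (x := x) ⟨h5.1, h3, h5.2.2.1, h4⟩, hyz.map₁,
      hyz.map_ne (x := ι x) ⟨h8.symm, fun h => h4 (by rw [← h, h2]),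
        fun h => h5.1 (hinj _ _ h), fun h => h3 (hinj _ _ h)⟩, hyz.map₃] at h7
  have hflip : ∀ x y, HasDoubleSwap G x y (ι x) (ι y) → HasDoubleSwap G x (ι y) (ι x) y →
      HasDoubleSwap G x (ι x) y (ι y) := fun x y h h' => h.right.mul h'.right
  have hconn : ∀ x y, y ≠ x → y ≠ ι x →
      HasDoubleSwap G x y (ι x) (ι y) ∨ HasDoubleSwap G x (ι y) (ι x) (ι (ι y)) := by
    -- Two pairs are related if some double transposition exchanges them, in either of the two ways.
    -- Generators respect this relation, so by transitivity all pairs are related.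
    let R : Setoid Ω :=
      { r := fun x y => y = x ∨ y = ι x ∨
          HasDoubleSwap G x y (ι x) (ι y) ∨ HasDoubleSwap G x (ι y) (ι x) (ι (ι y))
        iseqv := by
          refine ⟨fun x => .inl rfl, ?_, ?_⟩
          · rintro x y (rfl | rfl | h | h)
            · exact .inl rfl
            · exact .inr (.inl (h2 x).symm)
            · exact .inr (.inr (.inl (hsymm _ _ h)))
            · exact .inr (.inr (.inr (hswap _ _ (hsymm _ _ h))))
          · have key : ∀ x y z, HasDoubleSwap G x y (ι x) (ι y) →
                HasDoubleSwap G y z (ι y) (ι z) → z = x ∨ z = ι x ∨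
                HasDoubleSwap G x z (ι x) (ι z) := by
              intro x y z h h'
              by_cases h3 : z = x
              · exact .inl h3
              by_cases h4 : z = ι x
              · exact .inr (.inl h4)
              exact .inr (.inr (htrans x y z h h' (Ne.symm h3)
                fun h => h4 (by rw [h, h2])))
            have key' : ∀ x y z, HasDoubleSwap G x y (ι x) (ι y) →
                HasDoubleSwap G y (ι z) (ι y) (ι (ι z)) → z = x ∨ z = ι x ∨
                HasDoubleSwap G x (ι z) (ι x) (ι (ι z)) := by
              intro x y z h h'
              rcases key x y (ι z) h h' with h | h | h
              · exact .inr (.inl (by rw [← h, h2]))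
              · exact .inl (hinj _ _ h)
              · exact .inr (.inr h)
            rintro x y z (rfl | rfl | h | h) (rfl | rfl | h' | h')
            · exact .inl rfl
            · exact .inr (.inl rfl)
            · exact .inr (.inr (.inl h'))
            · exact .inr (.inr (.inr h'))
            · exact .inr (.inl rfl)
            · exact .inl (h2 x)
            · exact .inr (.inr (.inr (hswap _ _ h')))
            · have := hswap _ _ h'
              rw [h2 z] at this
              exact .inr (.inr (.inl this))
            · exact .inr (.inr (.inl h))
            · exact .inr (.inr (.inr (by rwa [h2])))
            · have := key x y z h h'; tauto
            · have := key' x y z h h'; tauto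
            · exact .inr (.inr (.inr h))
            · exact .inr (.inr (.inl h))
            · have := key' x (ι y) z h (hswap (ι y) z (by rwa [h2])); tauto
            · have := key x (ι y) z h (by
                have := hswap (ι y) (ι z) (by rwa [h2])
                rwa [h2 z] at this)
              tauto }
    intro x y h3 h4
    have := rel_of_isPretransitive hS R (fun σ hσ z => ?_) x y
    · rcases this with h | h | h <;> tauto
    · by_cases hz : σ z = z
      · exact .inl hz
      · rcases hasDoubleSwap_of_generator hS hind h0 h2 hι hσ hz with h | h
        · exact .inr (.inr (.inl h.2))
        · exact .inr (.inl h.1)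
  have hflip_exists : ∃ x, swap x (ι x) ∈ G ∨ ∃ y, HasDoubleSwap G x (ι x) y (ι y) := by
    by_contra! hcon
    -- Without flips, exchanging in one fixed way is already transitive: the only obstruction is `(x
    -- y)(ιx ιy)` together with `(x ιy)(ιx y)`, whose product flips two pairs. All generators
    -- respect this relation, so transitivity would relate `x` to `ι x`, which is absurd.
    let R : Setoid Ω :=
      { r := fun x y => y = x ∨ HasDoubleSwap G x y (ι x) (ι y)
        iseqv := by
          refine ⟨fun x => .inl rfl, ?_, ?_⟩
          · rintro x y (rfl | h)
            · exact .inl rfl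
            · exact .inr (hsymm _ _ h)
          · rintro x y z (rfl | h)
            · exact id
            · rintro (rfl | h')
              · exact .inr h
              · by_cases h3 : x = z
                · exact .inl h3.symm
                · by_cases h4 : x = ι z
                  · subst h4
                    refine absurd (hflip _ y h ?_) ((hcon _).2 y)
                    have h5 := h'.symm.left.right
                    rwa [h2 z]
                  · exact .inr (htrans x y z h h' h3 h4) }
    have := rel_of_isPretransitive hS R (fun σ hσ z => ?_) x (ι x)
    · rcases this with h | h
      · exact h0 x h
      · exact h.1.2.2.2.1 rfl
    · by_cases hz : σ z = z
      · exact .inl hz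
      · rcases hasDoubleSwap_of_generator hS hind h0 h2 hι hσ hz with h | ⟨-, h | ⟨y, h⟩⟩
        · exact .inr h.2
        · exact absurd h (hcon z).1
        · exact absurd h ((hcon z).2 y)
  -- If a single pair can be flipped, conjugation flips each pair. Otherwise a double flip is
  -- conjugated first so that it involves `x`, then by an exchange of the other pair `z` with `y`.
  have hflips : ∀ x y, y ≠ x → y ≠ ι x → HasDoubleSwap G x (ι x) y (ι y) := by
    obtain ⟨w, hw | ⟨v, hv⟩⟩ := hflip_exists
    · have hsw : ∀ x, swap x (ι x) ∈ G := by
        intro x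
        obtain ⟨g, rfl⟩ := MulAction.exists_smul_eq G w x
        have h3 := G.mul_mem (G.mul_mem g.2 hw) (G.inv_mem g.2)
        rw [← swap_apply_apply, hι _ g.2] at h3
        exact h3
      intro x y h3 h4
      exact ⟨⟨(h0 x).symm, h3.symm, fun h => h4 (by rw [h, h2]), h4.symm,
        fun h => h3 (hinj _ _ h).symm, (h0 y).symm⟩, G.mul_mem (hsw x) (hsw y)⟩
    · intro x y h3 h4
      obtain ⟨z, hz⟩ : ∃ z, HasDoubleSwap G x (ι x) z (ι z) := by
        obtain ⟨g, rfl⟩ := MulAction.exists_smul_eq G w x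
        have h3 := hv.conj g.2
        rw [hι _ g.2, hι _ g.2] at h3
        exact ⟨_, h3⟩
      by_cases h5 : z = y
      · exact h5 ▸ hz
      by_cases h6 : z = ι y
      · rw [h6, h2] at hz
        exact hz.right
      have h7 : z ≠ ι y := h6
      have hιyz : ι y ≠ z := Ne.symm h6
      have hyx : y ≠ ι x := h4
      have hιzy : y ≠ ι z := fun h => h6 (by rw [h, h2])
      have hxy' : x ≠ ι y := fun h => h4 (by rw [h, h2])
      rcases hconn z y (Ne.symm h5) hιzy with h | h
      · have h8 := hz.conj h.2
        rwa [h.map_ne (x := x) ⟨hz.1.2.1, h3.symm, hz.1.2.2.1, hxy'⟩,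
          h.map_ne (x := ι x) ⟨hz.1.2.2.2.1, h4.symm, hz.1.2.2.2.2.1,
            fun h => h3 (hinj _ _ h).symm⟩, h.map₁, h.map₃] at h8
      · rw [h2] at h
        have h8 := hz.conj h.2
        rw [h.map_ne (x := x) ⟨hz.1.2.1, hxy', hz.1.2.2.1, h3.symm⟩,
          h.map_ne (x := ι x) ⟨hz.1.2.2.2.1, fun h => h3 (hinj _ _ h).symm, hz.1.2.2.2.2.1,
            h4.symm⟩, h.map₁, h.map₃] at h8
        exact h8.right
  have hF := hflips x y hxy hxy'
  refine ⟨?_, hF⟩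
  -- One of the two exchanges is available; multiplying by the double flip gives the other.
  rcases hconn x y hxy hxy' with h | h
  · exact h
  · rw [h2] at h
    exact hF.right.mul h

end Wreath
section Wreath

variable {Ω : Type*} [Fintype Ω] [DecidableEq Ω]
variable {G : Subgroup (Perm Ω)} {ι : Ω → Ω}

/-- An even permutation commuting with a fixed point free involution is a product of double
transpositions of two pairs. -/
theorem mem_of_sign_eq_one (h0 : ∀ x, ι x ≠ x) (h2 : ∀ x, ι (ι x) = x)
    (hG : ∀ x y, y ≠ x → y ≠ ι x →
      HasDoubleSwap G x y (ι x) (ι y) ∧ HasDoubleSwap G x (ι x) y (ι y))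
    (σ : Perm Ω) (hσ : ∀ x, σ (ι x) = ι (σ x)) (hsign : Perm.sign σ = 1) : σ ∈ G := by
  have hinj : ∀ x y, ι x = ι y → x = y := fun x y h => by rw [← h2 x, h, h2]
  induction hn : σ.support.card using Nat.strong_induction_on generalizing σ with
  | _ n ih =>
  subst hn
  -- Multiplying by a double transposition supported within the support of `σ` and undoing `a ↦ b`
  -- shrinks the support.
  have step : ∀ a b c d, HasDoubleSwap G a b c d →
      (∀ x, (swap a b * swap c d) (ι x) = ι ((swap a b * swap c d) x)) →
      (∀ x, σ x = x → (x ≠ a ∧ x ≠ b ∧ x ≠ c ∧ x ≠ d)) → σ a = b → σ ∈ G := by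
    intro a b c d h hι hfix ha
    have hmem : swap a b * swap c d * σ ∈ G := by
      refine ih _ ?_ _ (fun x => ?_) ?_ rfl
      · apply Finset.card_lt_card
        rw [Finset.ssubset_iff_of_subset]
        · refine ⟨a, Perm.mem_support.2 fun h' => (hfix a h').1 rfl, ?_⟩
          rw [Perm.notMem_support, Perm.mul_apply, ha, h.map₂]
        · intro x hx
          rw [Perm.mem_support] at hx ⊢
          intro hx'
          rw [Perm.mul_apply, hx', h.map_ne (hfix x hx')] at hx
          exact hx rfl
      · rw [Perm.mul_apply, hσ, hι, Perm.mul_apply (swap a b * swap c d)]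
      · have h1 := h.1
        rw [map_mul, map_mul, hsign, Perm.sign_swap h1.1, Perm.sign_swap h1.2.2.2.2.2]
        rfl
    have h3 := G.mul_mem (G.inv_mem h.2) hmem
    rwa [inv_mul_cancel_left] at h3
  by_cases hcase : ∃ a, σ a ≠ a ∧ σ a ≠ ι a
  · obtain ⟨a, ha, ha'⟩ := hcase
    have h := (hG a (σ a) ha ha').1
    refine step _ _ _ _ h (fun x => ?_) (fun x hx => ?_) rfl
    · by_cases h3 : x = a
      · rw [h3, h.map₃, h.map₁]
      by_cases h4 : x = σ a
      · rw [h4, h.map₄, h.map₂]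
      by_cases h5 : x = ι a
      · rw [h5, h.map₃, h2, h2, h.map₁]
      by_cases h6 : x = ι (σ a)
      · rw [h6, h.map₄, h2, h2, h.map₂]
      rw [h.map_ne ⟨h3, h4, h5, h6⟩, h.map_ne ⟨fun h => h5 (by rw [← h, h2]),
        fun h => h6 (by rw [← h, h2]), fun h => h3 (hinj _ _ h), fun h => h4 (hinj _ _ h)⟩]
    · refine ⟨?_, ?_, ?_, ?_⟩
      · rintro rfl; exact ha hx
      · rintro rfl; exact ha (σ.injective hx)
      · rintro rfl
        rw [hσ] at hx
        exact ha (hinj _ _ hx)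
      · rintro rfl
        rw [hσ] at hx
        exact ha (σ.injective (hinj _ _ hx))
  · have hcase' : ∀ x, σ x ≠ x → σ x = ι x := by
      intro x hx
      by_contra h
      exact hcase ⟨x, hx, h⟩
    by_cases hone : σ = 1
    · exact hone ▸ G.one_mem
    obtain ⟨a, ha⟩ : ∃ a, σ a ≠ a := by
      by_contra! h
      exact hone (Perm.ext h)
    -- Every moved pair is flipped here. A single flip would be odd, so a second pair is flipped
    -- too.
    obtain ⟨b, hb, hba, hba'⟩ : ∃ b, σ b ≠ b ∧ b ≠ a ∧ b ≠ ι a := by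
      by_contra! hcon
      have h3 : σ = swap a (ι a) := by
        ext x
        by_cases hx : x = a
        · rw [hx, swap_apply_left, hcase' a ha]
        by_cases hx' : x = ι a
        · rw [hx', swap_apply_right, hσ, hcase' a ha, h2]
        rw [swap_apply_of_ne_of_ne hx hx']
        by_contra h
        exact hx' (hcon x h hx)
      rw [h3, Perm.sign_swap (h0 a).symm] at hsign
      exact absurd hsign (by decide)
    have h := (hG a b hba hba').2
    refine step _ _ _ _ h (fun x => ?_) (fun x hx => ?_) (hcase' a ha)
    · by_cases h3 : x = a
      · rw [h3, h.map₁, h.map₂, h2]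
      by_cases h4 : x = b
      · rw [h4, h.map₃, h.map₄, h2]
      by_cases h5 : x = ι a
      · rw [h5, h.map₂, h2, h.map₁]
      by_cases h6 : x = ι b
      · rw [h6, h.map₄, h2, h.map₃]
      rw [h.map_ne ⟨h3, h5, h4, h6⟩, h.map_ne ⟨fun h => h5 (by rw [← h, h2]),
        fun h => h3 (hinj _ _ h), fun h => h6 (by rw [← h, h2]), fun h => h4 (hinj _ _ h)⟩]
    · refine ⟨?_, ?_, ?_, ?_⟩
      · rintro rfl; exact ha hx
      · rintro rfl
        rw [hσ] at hx
        exact ha (hinj _ _ hx)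
      · rintro rfl; exact hb hx
      · rintro rfl
        rw [hσ] at hx
        exact hb (hinj _ _ hx)

/-- Both permutations of two points commute with `d ↦ d + 1`, so the wreath product is the full
centraliser of the involution exchanging the points of each pair. -/
theorem mem_c2WreathSym {m : ℕ} (σ : Perm (Fin m × Fin 2)) :
    σ ∈ c2WreathSym m ↔ ∀ i d, σ (i, d + 1) = ((σ (i, d)).1, (σ (i, d)).2 + 1) := by
  constructor
  · rintro ⟨h, -, f, -, hσ⟩ i d
    have key : ∀ (f : Perm (Fin 2)) d, f (d + 1) = f d + 1 := by decide
    rw [hσ, hσ, key]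
  · intro hσ
    have h01 : ∀ d : Fin 2, d = 0 ∨ d = 0 + 1 := by decide
    have hfst : ∀ i d, (σ (i, d)).1 = (σ (i, 0)).1 := by
      intro i d
      rcases h01 d with rfl | rfl
      · rfl
      · rw [hσ]
    have hsnd : ∀ i d, (σ (i, d)).2 = d + (σ (i, 0)).2 := by
      intro i d
      rcases h01 d with rfl | rfl
      · rw [zero_add]
      · rw [hσ, zero_add, add_comm]
    have hinj : Function.Injective fun i => (σ (i, 0)).1 := by
      intro i j hij
      have h1 : σ (i, (σ (j, 0)).2 - (σ (i, 0)).2) = σ (j, 0) := by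
        apply Prod.ext
        · rw [hfst]; exact hij
        · rw [hsnd, sub_add_cancel]
      exact congrArg Prod.fst (σ.injective h1)
    refine ⟨Equiv.ofBijective _ (Finite.injective_iff_bijective.1 hinj), trivial,
      fun i => Equiv.addRight (σ (i, 0)).2, fun _ => trivial, fun i d => ?_⟩
    exact Prod.ext (hfst i d) (hsnd i d)

/-- The points can be labelled by pairs such that a given fixed point free involution exchanges the
two members of each pair. -/
theorem exists_equiv_prod_fin_two {Ω : Type*} [Fintype Ω] {ι : Ω → Ω} (h0 : ∀ x, ι x ≠ x) (h2 : ∀ x, ι (ι x) = x) :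
    ∃ (m : ℕ) (e : Ω ≃ Fin m × Fin 2), ∀ x, e (ι x) = ((e x).1, (e x).2 + 1) := by
  let r : Setoid Ω :=
    { r := fun x y => y = x ∨ y = ι x
      iseqv := by
        refine ⟨fun x => .inl rfl, ?_, ?_⟩
        · rintro x y (rfl | rfl)
          · exact .inl rfl
          · exact .inr (h2 x).symm
        · rintro x y z (rfl | rfl) (rfl | rfl)
          · exact .inl rfl
          · exact .inr rfl
          · exact .inr rfl
          · exact .inl (h2 x) }
  classical
  let q := Fintype.equivFin (Quotient r)
  let F : Quotient r × Fin 2 → Ω := fun p => if p.2 = 0 then p.1.out else ι p.1.out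
  have hF : ∀ (c : Quotient r) (d : Fin 2), F (c, d + 1) = ι (F (c, d)) := by
    intro c d
    fin_cases d
    · simp [F]
    · simp [F, h2]
  have hmk : ∀ p, (⟦F p⟧ : Quotient r) = p.1 := by
    rintro ⟨c, d⟩
    by_cases hd : d = 0
    · simp [F, hd]
    · simp only [F, if_neg hd]
      conv_rhs => rw [← Quotient.out_eq c]
      exact Quotient.sound (r.symm (.inr rfl : r c.out (ι c.out)))
  have hbij : Function.Bijective F := by
    constructor
    · rintro ⟨c, d⟩ ⟨c', d'⟩ h
      have hc : c = c' := (hmk (c, d)).symm.trans (h ▸ hmk (c', d'))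
      subst hc
      have : d = d' := by
        by_contra hne
        have h1 : d' = d + 1 := by clear h; revert d d'; decide
        rw [h1, hF] at h
        exact h0 _ h.symm
      rw [this]
    · intro x
      have h1 : r x (Quotient.out ⟦x⟧) := r.symm (Quotient.mk_out (s := r) x)
      rcases h1 with h1 | h1
      · exact ⟨(⟦x⟧, 0), by simp only [F, if_pos]; exact h1⟩
      · refine ⟨(⟦x⟧, 1), ?_⟩
        have : F ((⟦x⟧ : Quotient r), 1) = ι (Quotient.out ⟦x⟧) := rfl
        rw [this, h1, h2]
  let E := Equiv.ofBijective F hbij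
  refine ⟨_, E.symm.trans (q.prodCongr (Equiv.refl _)), fun x => ?_⟩
  obtain ⟨⟨c, d⟩, rfl⟩ := E.surjective x
  have h1 : ι (E (c, d)) = E (c, d + 1) := (hF c d).symm
  simp [h1]

/-- `G` lies between the centraliser of `ι` and its even part. One odd element of `G` is enough to
make it the whole centraliser. -/
theorem isPermIso_of_not_isPreprimitive [MulAction.IsPretransitive G Ω]
    (hgi : generatorIndex G ≤ 2) (hprim : ¬ MulAction.IsPreprimitive G Ω) :
    ∃ m : ℕ, Fintype.card Ω = 2 * m ∧ (IsPermIso G (c2WreathSym m) ∨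
      IsPermIso G (c2WreathSym m ⊓ alternatingGroup (Fin m × Fin 2))) := by
  obtain ⟨S, hS, hind⟩ := exists_generating_set hgi
  obtain ⟨ι, h0, h2, hι⟩ := exists_involutive_of_not_isPreprimitive hS hind hprim
  have hle := mem_of_sign_eq_one h0 h2
    fun x y hxy hxy' => hasDoubleSwap_of_pairs hS hind h0 h2 hι hxy hxy'
  obtain ⟨m, e, he⟩ := exists_equiv_prod_fin_two h0 h2
  have hmem : ∀ σ : Perm Ω, e.permCongr σ ∈ c2WreathSym m ↔ ∀ x, σ (ι x) = ι (σ x) := by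
    intro σ
    rw [mem_c2WreathSym]
    have h1 : ∀ x, e.permCongr σ ((e x).1, (e x).2 + 1) = e (σ (ι x)) := by
      intro x
      rw [← he, permCongr_apply, symm_apply_apply]
    have h3 : ∀ x, e.permCongr σ (e x) = e (σ x) := by
      intro x
      rw [permCongr_apply, symm_apply_apply]
    constructor
    · intro h x
      apply e.injective
      rw [← h1, h, he]
      change ((e.permCongr σ (e x)).1, (e.permCongr σ (e x)).2 + 1) = _
      rw [h3]
    · intro h i d
      obtain ⟨x, hx⟩ := e.surjective (i, d)
      have h4 := h1 x
      rw [hx] at h4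
      rw [h4, h, he, ← h3, hx]
  refine ⟨m, ?_, ?_⟩
  · rw [Fintype.card_congr e, Fintype.card_prod, Fintype.card_fin, Fintype.card_fin, mul_comm]
  by_cases hodd : ∃ g ∈ G, Perm.sign g ≠ 1
  · obtain ⟨g, hg, hg'⟩ := hodd
    refine .inl (isPermIso_of_mem_iff e fun σ => ?_)
    rw [hmem]
    refine ⟨hι σ, fun h => ?_⟩
    by_cases hs : Perm.sign σ = 1
    · exact hle σ h hs
    · have h1 : g * σ ∈ G := by
        refine hle _ (fun x => ?_) ?_
        · rw [Perm.mul_apply, h, hι g hg, Perm.mul_apply]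
        · rw [map_mul, (Int.units_eq_one_or _).resolve_left hg',
            (Int.units_eq_one_or _).resolve_left hs]
          rfl
      exact (G.mul_mem_cancel_left hg).1 h1
  · push Not at hodd
    refine .inr (isPermIso_of_mem_iff e fun σ => ?_)
    rw [Subgroup.mem_inf, hmem, Perm.mem_alternatingGroup, Perm.sign_permCongr]
    exact ⟨fun h => ⟨hι σ h, hodd σ h⟩, fun h => hle σ h.1 h.2⟩

end Wreath
-- The pentagon and the points outside it
section Pentagon

variable {Ω : Type*} [DecidableEq Ω] {G : Subgroup (Perm Ω)} {f : ZMod 5 → Ω}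

/-- The group `G` contains all reflections of the pentagon with vertices `f 0, …, f 4`, acting
trivially on the remaining points. -/
def IsPentagon (G : Subgroup (Perm Ω)) (f : ZMod 5 → Ω) : Prop :=
  Function.Injective f ∧ ∀ i j k m, i ≠ j → k ≠ m → i ≠ k → i ≠ m → i + j = k + m →
    HasDoubleSwap G (f i) (f j) (f k) (f m)

/-- The reflection `t ↦ p + q - t` has exactly two 2-cycles, so it is a double transposition in
eight notations. -/
theorem reflection_unique : ∀ p q r i k : ZMod 5, p ≠ q → r ≠ p + q - r → p ≠ r → q ≠ r →
    i ≠ p + q - i → k ≠ p + q - k → i ≠ k → i ≠ p + q - k →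
    (i = p ∧ k = r) ∨ (i = p ∧ k = p + q - r) ∨ (i = q ∧ k = r) ∨ (i = q ∧ k = p + q - r) ∨
    (i = r ∧ k = p) ∨ (i = r ∧ k = q) ∨ (i = p + q - r ∧ k = p) ∨ (i = p + q - r ∧ k = q) := by
  decide +kernel

theorem HasDoubleSwap.of_reflection {p q r s : ZMod 5}
    (h : HasDoubleSwap G (f p) (f q) (f r) (f s)) (hs : p + q = r + s) {i j k m : ZMod 5}
    (hij : i ≠ j) (hkm : k ≠ m) (hik : i ≠ k) (him : i ≠ m) (hi : i + j = p + q)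
    (hk : k + m = p + q) : HasDoubleSwap G (f i) (f j) (f k) (f m) := by
  have hne := h.1
  obtain rfl : s = p + q - r := by rw [hs]; ring
  obtain rfl : j = p + q - i := by rw [← hi]; ring
  obtain rfl : m = p + q - k := by rw [← hk]; ring
  have hf : ∀ {x y}, f x ≠ f y → x ≠ y := fun h h' => h (congrArg f h')
  rcases reflection_unique p q r i k (hf hne.1) (hf hne.2.2.2.2.2) (hf hne.2.1)
    (hf hne.2.2.2.1) hij hkm hik him with h' | h' | h' | h' | h' | h' | h' | h' <;>
    obtain ⟨rfl, rfl⟩ := h' <;> simp only [add_sub_cancel_left, add_sub_cancel_right,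
      sub_sub_cancel]
  · exact h
  · exact h.right
  · exact h.left
  · exact h.left.right
  · exact h.symm
  · exact h.symm.right
  · exact h.symm.left
  · exact h.symm.left.right

theorem exists_isPentagon {a b c d e : Ω} (h : HasDoubleSwap G a b c d)
    (h' : HasDoubleSwap G a c b e) (hde : d ≠ e) : ∃ f, IsPentagon G f := by
  have h1 := h.1
  have h2 := h'.1
  -- In this labelling the two given elements are the reflections `t ↦ -t` and `t ↦ 1 - t`; the
  -- other three are obtained by conjugation.
  let f : ZMod 5 → Ω := ![e, b, c, d, a]
  have x0 : HasDoubleSwap G (f 1) (f 4) (f 2) (f 3) := h.left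
  have x1 : HasDoubleSwap G (f 0) (f 1) (f 2) (f 4) := h'.symm.left.right
  have hinj : Function.Injective f := by
    have h3 : [e, b, c, d, a].Nodup := by
      simp only [List.nodup_cons, List.mem_cons, List.not_mem_nil, not_or]
      have := h1.1.symm
      have := h1.2.1.symm
      have := h1.2.2.1.symm
      have := h2.2.2.1.symm
      have := h2.2.2.2.2.1.symm
      have := h2.2.2.2.2.2.symm
      have := hde.symm
      simp only [not_false_eq_true, List.nodup_nil]
      tauto
    have := List.nodup_iff_injective_get.1 h3
    intro i j hij
    apply this
    revert hij
    revert i j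
    intro (i : Fin 5) (j : Fin 5) hij
    fin_cases i <;> fin_cases j <;> exact hij
  have hne : ∀ {i j}, i ≠ j → f i ≠ f j := fun h h' => h (hinj h')
  have x2 : HasDoubleSwap G (f 0) (f 2) (f 4) (f 3) := by
    have h3 := x0.conj x1.2
    rwa [x1.map₂, x1.map₄, x1.map₃, x1.map_ne (x := f 3)
      ⟨hne (by decide), hne (by decide), hne (by decide), hne (by decide)⟩] at h3
  have y0 : ∀ {g : Perm Ω}, g = swap (f 1) (f 4) * swap (f 2) (f 3) → g (f 0) = f 0 := by
    rintro _ rfl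
    exact x0.map_ne ⟨hne (by decide), hne (by decide), hne (by decide), hne (by decide)⟩
  have x4 : HasDoubleSwap G (f 0) (f 4) (f 3) (f 1) := by
    have h3 := x1.conj x0.2
    rwa [y0 rfl, x0.map₁, x0.map₃, x0.map₂] at h3
  have x3 : HasDoubleSwap G (f 0) (f 3) (f 1) (f 2) := by
    have h3 := x2.conj x0.2
    rwa [y0 rfl, x0.map₃, x0.map₂, x0.map₄] at h3
  refine ⟨f, hinj, fun i j k m hij hkm hik him hs => ?_⟩
  have h5 : ∀ s : ZMod 5, s = 0 ∨ s = 1 ∨ s = 2 ∨ s = 3 ∨ s = 4 := by decide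
  rcases h5 (i + j) with h | h | h | h | h
  · exact x0.of_reflection (by decide) hij hkm hik him (h.trans (by decide))
      (hs.symm.trans (h.trans (by decide)))
  · exact x1.of_reflection (by decide) hij hkm hik him (h.trans (by decide))
      (hs.symm.trans (h.trans (by decide)))
  · exact x2.of_reflection (by decide) hij hkm hik him (h.trans (by decide))
      (hs.symm.trans (h.trans (by decide)))
  · exact x3.of_reflection (by decide) hij hkm hik him (h.trans (by decide))
      (hs.symm.trans (h.trans (by decide)))
  · exact x4.of_reflection (by decide) hij hkm hik him (h.trans (by decide))
      (hs.symm.trans (h.trans (by decide)))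

namespace IsPentagon

variable (hf : IsPentagon G f) (hG : NoThreeCycle G)
include hf hG

/-- Compare with the reflection that contains `(i j)`: it moves `k` or `m`, so `not_share` applies.
-/
theorem add_eq {i j k m : ZMod 5} (h : HasDoubleSwap G (f i) (f j) (f k) (f m)) :
    i + j = k + m := by
  have h1 := h.1
  have hne : ∀ {x y}, f x ≠ f y → x ≠ y := fun h h' => h (congrArg f h')
  by_contra hs
  by_cases hk : i + j = k + k
  · have key : ∀ k m : ZMod 5, k ≠ m → m ≠ k + k - m ∧ k ≠ k + k - m := by decide
    obtain ⟨h2, h4⟩ := key k m (hne h1.2.2.2.2.2)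
    rw [← hk] at h2 h4
    have h3 : i ≠ i + j - m := fun h => hne h1.2.2.2.2.1 (by linear_combination -h)
    exact h4 (hf.1 (h.right.not_share hG (hf.2 i j m (i + j - m) (hne h1.1) h2
      (hne h1.2.2.1) h3 (by ring))))
  · have h2 : m = i + j - k := hf.1 (h.not_share hG (hf.2 i j k (i + j - k) (hne h1.1)
      (fun h => hk (by linear_combination -h)) (hne h1.2.1)
      (fun h => hne h1.2.2.2.1 (by linear_combination -h)) (by ring)))
    exact hs (by rw [h2]; ring)

theorem not_meet_once {a b c : Ω} {i : ZMod 5} (h : HasDoubleSwap G (f i) a b c)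
    (ha : a ∉ Set.range f) (hb : b ∉ Set.range f) (hc : c ∉ Set.range f) : False := by
  have key : ∀ i : ZMod 5, ∃ j k m, i ≠ j ∧ k ≠ m ∧ i ≠ k ∧ i ≠ m ∧ i + j = k + m := by
    decide
  obtain ⟨j, k, m, h1, h2, h3, h4, h5⟩ := key i
  have hne : ∀ {x y}, x ∉ Set.range f → x ≠ f y := fun h h' => h ⟨_, h'.symm⟩
  exact HasDoubleSwap.not_meet_once hG (hf.2 i j k m h1 h2 h3 h4 h5) h
    ⟨⟨hne ha, hne ha, hne ha⟩, ⟨hne hb, hne hb, hne hb⟩, hne hc, hne hc, hne hc⟩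

/-- The reflection that fixes `j` moves `i`, so its support would meet the given one in `f i` alone.
-/
theorem not_meet_twice {a b c : Ω} {i j : ZMod 5} (h : HasDoubleSwap G (f i) a b c) (hij : i ≠ j)
    (ha : a = f j ∨ a ∉ Set.range f) (hb : b = f j ∨ b ∉ Set.range f)
    (hc : c = f j ∨ c ∉ Set.range f) : False := by
  have key : ∀ i l : ZMod 5, i ≠ l → ∃ j k m, i ≠ j ∧ k ≠ m ∧ i ≠ k ∧ i ≠ m ∧ i + j = k + m ∧
      l ≠ j ∧ l ≠ k ∧ l ≠ m := by
    decide +kernel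
  obtain ⟨l, k, m, h1, h2, h3, h4, h5, h6, h7, h8⟩ := key i j hij
  have hne : ∀ {x y}, j ≠ y → (x = f j ∨ x ∉ Set.range f) → x ≠ f y := by
    rintro x y hy (rfl | hx)
    · exact fun h => hy (hf.1 h)
    · exact fun h => hx ⟨_, h.symm⟩
  exact HasDoubleSwap.not_meet_once hG (hf.2 i l k m h1 h2 h3 h4 h5) h
    ⟨⟨hne h6 ha, hne h7 ha, hne h8 ha⟩, ⟨hne h6 hb, hne h7 hb, hne h8 hb⟩,
      hne h6 hc, hne h7 hc, hne h8 hc⟩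

/-- A double transposition that exchanges a vertex of the pentagon with an outer point moves
exactly two further vertices, symmetric to the first. -/
theorem of_cross {i : ZMod 5} {a b c : Ω} (h : HasDoubleSwap G a (f i) b c)
    (ha : a ∉ Set.range f) : ∃ j k, b = f j ∧ c = f k ∧ j ≠ k ∧ j + k = i + i := by
  have h1 := h.1
  have hne : ∀ {x y}, f x ≠ f y → x ≠ y := fun h h' => h (congrArg f h')
  by_cases hb : b ∈ Set.range f
  · obtain ⟨j, rfl⟩ := hb
    by_cases hc : c ∈ Set.range f
    · obtain ⟨k, rfl⟩ := hc
      refine ⟨j, k, rfl, rfl, hne h1.2.2.2.2.2, ?_⟩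
      -- The reflection containing `(j k)` then moves `i`, and `not_share` puts `a` on the pentagon.
      by_contra hs
      refine ha ⟨j + k - i, ?_⟩
      exact (HasDoubleSwap.not_share hG h.symm.right (hf.2 j k i (j + k - i) (hne h1.2.2.2.2.2)
        (fun h => hs (by linear_combination -h)) (hne h1.2.2.2.1).symm
        (fun h => hne h1.2.2.2.2.1 (by linear_combination h)) (by ring))).symm
    · exact (not_meet_twice hf hG h.left (hne h1.2.2.2.1) (.inr ha) (.inl rfl) (.inr hc)).elim
  · by_cases hc : c ∈ Set.range f
    · obtain ⟨k, rfl⟩ := hc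
      exact (not_meet_twice hf hG h.left (hne h1.2.2.2.2.1) (.inr ha) (.inr hb) (.inl rfl)).elim
    · exact (not_meet_once hf hG h.left ha hb hc).elim

omit hG in
theorem exists_reflection (s : ZMod 5) :
    ∃ g ∈ G, (∀ i, g (f i) = f (s - i)) ∧ ∀ a ∉ Set.range f, g a = a := by
  have key : ∀ s : ZMod 5, ∃ i j k m, i ≠ j ∧ k ≠ m ∧ i ≠ k ∧ i ≠ m ∧ i + j = k + m ∧
      ∀ x, (x = i ∧ s - x = j) ∨ (x = j ∧ s - x = i) ∨ (x = k ∧ s - x = m) ∨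
      (x = m ∧ s - x = k) ∨ (x ≠ i ∧ x ≠ j ∧ x ≠ k ∧ x ≠ m ∧ s - x = x) := by
    decide +kernel
  obtain ⟨i, j, k, m, h1, h2, h3, h4, h5, h6⟩ := key s
  have h := hf.2 i j k m h1 h2 h3 h4 h5
  refine ⟨_, h.2, fun x => ?_, fun a ha => h.map_ne
    ⟨fun h => ha ⟨_, h.symm⟩, fun h => ha ⟨_, h.symm⟩, fun h => ha ⟨_, h.symm⟩,
      fun h => ha ⟨_, h.symm⟩⟩⟩
  rcases h6 x with ⟨hx, hx'⟩ | ⟨hx, hx'⟩ | ⟨hx, hx'⟩ | ⟨hx, hx'⟩ | ⟨h7, h8, h9, h10, hx'⟩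
  · rw [hx', hx, h.map₁]
  · rw [hx', hx, h.map₂]
  · rw [hx', hx, h.map₃]
  · rw [hx', hx, h.map₄]
  · rw [hx']
    exact h.map_ne ⟨hf.1.ne h7, hf.1.ne h8, hf.1.ne h9, hf.1.ne h10⟩

/-- Conjugate by the reflection exchanging `i` and `j`, which fixes `a`. If the result contains the
other pair symmetric about `j`, multiply by the reflection fixing `j`. -/
theorem hasDoubleSwap_infinity {a : Ω} (ha : a ∉ Set.range f) {i : ZMod 5} {b c : Ω}
    (h : HasDoubleSwap G a (f i) b c) {j k l : ZMod 5} (hkl : k ≠ l) (hs : k + l = j + j) :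
    HasDoubleSwap G a (f j) (f k) (f l) := by
  obtain ⟨g, hg, hgf, hga⟩ := hf.exists_reflection (i + j)
  have h1 := h.conj hg
  rw [hga a ha, hgf, add_sub_cancel_left] at h1
  obtain ⟨k', l', hb, hc, hkl', hs'⟩ := hf.of_cross hG h1 ha
  rw [hb, hc] at h1
  have key : ∀ k l k' l' : ZMod 5, k ≠ l → k' ≠ l' → k + l = k' + l' →
      (k = k' ∧ l = l') ∨ (k = l' ∧ l = k') ∨ (k' ≠ k ∧ k' ≠ l ∧ l' ≠ k ∧ l' ≠ l) := by
    decide +kernel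
  rcases key k l k' l' hkl hkl' (hs.trans hs'.symm) with ⟨rfl, rfl⟩ | ⟨rfl, rfl⟩ | hne
  · exact h1
  · exact h1.right
  · have h2 := hf.2 k' l' k l hkl' hkl hne.1 hne.2.1 (hs'.trans hs.symm)
    have h4 : ∀ m, f m ≠ a := fun m hm => ha ⟨m, hm⟩
    have hjk : j ≠ k := fun h => hkl (by rw [h] at hs; linear_combination -hs)
    have hjl : j ≠ l := fun h => hkl (by rw [h] at hs; linear_combination hs)
    refine h1.symm.cancel h2 ⟨(h4 k).symm, (h4 l).symm, hf.1.ne hjk, hf.1.ne hjl⟩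

/-- A double transposition leading from the six points to a seventh would meet a known one in a
single point, or share with it a transposition and one further point. -/
theorem eq_infinity (hgen : IsDoubleSwapGenerated G) [MulAction.IsPretransitive G Ω] {a : Ω}
    (ha : a ∉ Set.range f) (h : ∀ j k l, k ≠ l → k + l = j + j →
      HasDoubleSwap G a (f j) (f k) (f l)) {b : Ω} (hb : b ∉ Set.range f) : b = a := by
  by_contra hba
  obtain ⟨p, q, r, s, hD, hp, hq⟩ := hgen.exists_cross (s := insert a (Set.range f))
    (Set.mem_insert a _) (show b ∉ insert a (Set.range f) by simp [hba, -Set.mem_range, hb])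
  simp only [Set.mem_insert_iff, not_or] at hq
  rcases hp with rfl | ⟨i, rfl⟩
  · by_cases hr : r ∈ Set.range f
    · obtain ⟨i, rfl⟩ := hr
      by_cases hs : s ∈ Set.range f
      · obtain ⟨j, rfl⟩ := hs
        exact not_meet_twice hf hG hD.symm (fun h => hD.1.2.2.2.2.2 (congrArg f h)) (.inl rfl)
          (.inr ha) (.inr hq.2)
      · exact not_meet_once hf hG hD.symm hs ha hq.2
    · by_cases hs : s ∈ Set.range f
      · obtain ⟨j, rfl⟩ := hs
        exact not_meet_once hf hG hD.right.symm hr ha hq.2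
      · have hne : ∀ {x y}, x ∉ Set.range f → x ≠ f y := fun h h' => h ⟨_, h'.symm⟩
        exact HasDoubleSwap.not_meet_once hG (h 0 1 4 (by decide) (by decide)) hD
          ⟨⟨hne hq.2, hne hq.2, hne hq.2⟩, ⟨hne hr, hne hr, hne hr⟩, hne hs, hne hs, hne hs⟩
  · obtain ⟨j, k, rfl, rfl, hjk, hs⟩ := hf.of_cross hG hD.left hq.2
    exact hq.1 (HasDoubleSwap.not_share hG hD.symm (h i j k hjk hs).symm.right)

end IsPentagon
end Pentagon
-- The projective line over `𝔽₅` in affine coordinates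
section ProjSpecialLinear

theorem mem_projSpecialLinear {d : ℕ} {K : Type*} [Field K]
    {σ : Perm (Projectivization K (Fin d → K))} :
    σ ∈ projSpecialLinear d K ↔
      ∃ A : Matrix.SpecialLinearGroup (Fin d) K, ∀ x, σ x = A • x := by
  constructor
  · rintro ⟨A, rfl⟩
    induction A using QuotientGroup.induction_on with
    | H A => exact ⟨A, fun x => rfl⟩
  · rintro ⟨A, hA⟩
    exact ⟨(A : Matrix.ProjectiveSpecialLinearGroup (Fin d) K), Equiv.ext fun x => (hA x).symm⟩

/-- The Möbius transformation with matrix `!![a, b; c, d]` on the projective line over `𝔽₅`;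
note that `x ^ 3` is the inverse of `x`. -/
def moebius (a b c d : ZMod 5) : Option (ZMod 5) → Option (ZMod 5)
  | none => if c = 0 then none else some (a * c ^ 3)
  | some t => if c * t + d = 0 then none else some ((a * t + b) * (c * t + d) ^ 3)

/-- The point of the projective line over `𝔽₅` with a given affine coordinate. -/
noncomputable def projPoint : Option (ZMod 5) → Projectivization (ZMod 5) (Fin 2 → ZMod 5)
  | none => .mk _ ![1, 0] (by simp)
  | some t => .mk _ ![t, 1] (by simp)

theorem projPoint_bijective : Function.Bijective projPoint := by
  constructor
  · rintro (_ | s) (_ | t) h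
    · rfl
    · obtain ⟨a, ha⟩ := (Projectivization.mk_eq_mk_iff' _ _ _ _ _).1 h
      have h0 := congrFun ha 0
      have h1 := congrFun ha 1
      simp at h0 h1
      simp [h1] at h0
    · obtain ⟨a, ha⟩ := (Projectivization.mk_eq_mk_iff' _ _ _ _ _).1 h
      have h1 := congrFun ha 1
      simp at h1
    · obtain ⟨a, ha⟩ := (Projectivization.mk_eq_mk_iff' _ _ _ _ _).1 h
      have h0 := congrFun ha 0
      have h1 := congrFun ha 1
      simp at h0 h1
      simp [h1] at h0
      rw [h0]
  · intro x
    induction x using Projectivization.ind with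
    | h v hv =>
      by_cases h1 : v 1 = 0
      · refine ⟨none, (Projectivization.mk_eq_mk_iff' _ _ _ _ _).2 ⟨(v 0)⁻¹, ?_⟩⟩
        have h0 : v 0 ≠ 0 := fun h0 => hv (by ext i; fin_cases i <;> simp [h0, h1])
        ext i
        fin_cases i <;> simp [h0, h1]
      · refine ⟨some (v 0 * (v 1)⁻¹), (Projectivization.mk_eq_mk_iff' _ _ _ _ _).2
          ⟨(v 1)⁻¹, ?_⟩⟩
        ext i
        fin_cases i <;> simp [h1, mul_comm]

theorem smul_projPoint (A : Matrix.SpecialLinearGroup (Fin 2) (ZMod 5)) (t : Option (ZMod 5)) :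
    A • projPoint t = projPoint (moebius (A 0 0) (A 0 1) (A 1 0) (A 1 1) t) := by
  have h4 : ∀ x : ZMod 5, x ≠ 0 → x ^ 3 * x = 1 := by decide
  have hdet := A.det_coe
  rw [Matrix.det_fin_two] at hdet
  have hsmul : ∀ v : Fin 2 → ZMod 5, A • v = ![A 0 0 * v 0 + A 0 1 * v 1,
      A 1 0 * v 0 + A 1 1 * v 1] := by
    intro v
    rw [Matrix.SpecialLinearGroup.smul_def, Matrix.smul_eq_mulVec]
    ext i
    fin_cases i <;> simp [Matrix.mulVec, dotProduct, Fin.sum_univ_two]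
  rcases t with _ | t
  · simp only [projPoint, moebius]
    rw [Projectivization.smul_mk]
    by_cases hc : A 1 0 = 0
    · simp only [hc, if_true]
      refine (Projectivization.mk_eq_mk_iff' _ _ _ _ _).2 ⟨A 0 0, ?_⟩
      rw [hsmul]
      ext i
      fin_cases i <;> simp [hc]
    · simp only [hc, if_false]
      refine (Projectivization.mk_eq_mk_iff' _ _ _ _ _).2 ⟨A 1 0, ?_⟩
      rw [hsmul]
      have := h4 _ hc
      ext i
      fin_cases i <;> simp
      linear_combination (A 0 0) * this
  · simp only [projPoint, moebius]
    rw [Projectivization.smul_mk]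
    by_cases hc : A 1 0 * t + A 1 1 = 0
    · simp only [hc, if_true]
      refine (Projectivization.mk_eq_mk_iff' _ _ _ _ _).2 ⟨A 0 0 * t + A 0 1, ?_⟩
      rw [hsmul]
      ext i
      fin_cases i <;> simp [hc]
    · simp only [hc, if_false]
      refine (Projectivization.mk_eq_mk_iff' _ _ _ _ _).2 ⟨A 1 0 * t + A 1 1, ?_⟩
      rw [hsmul]
      have := h4 _ hc
      ext i
      fin_cases i <;> simp
      linear_combination (A 0 0 * t + A 0 1) * this

end ProjSpecialLinear
-- Identification of `D₅` and `PSL₂(5)`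
section Pentagon

theorem permCongr_swap_mul_swap {Ω Ω' : Type*} [DecidableEq Ω] [DecidableEq Ω'] (e : Ω ≃ Ω')
    (a b c d : Ω) :
    e.permCongr (swap a b * swap c d) = swap (e a) (e b) * swap (e c) (e d) := by
  ext x
  obtain ⟨x, rfl⟩ := e.surjective x
  simp only [permCongr_apply, symm_apply_apply, Perm.mul_apply, ← e.injective.swap_apply]

theorem swap_mul_swap_eq_dihedral : ∀ i j k : ZMod 5, i ≠ j → k ≠ i + j - k → i ≠ k → j ≠ k →
    ∀ t, (swap i j * swap k (i + j - k)) t = -(t + -(i + j)) := by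
  decide +kernel

theorem dihedral_eq_swap_mul_swap : ∀ i t : ZMod 5,
    (swap (1 + 2 * i) (-1 + 2 * i) * swap (2 + 2 * i) (-2 + 2 * i)) t = -(t + i) := by
  decide +kernel

/-- The map is `t ↦ i + j - t`. Its obvious matrix has determinant `-1`; scaling by `2` multiplies
this by `4 = -1`. -/
theorem swap_mul_swap_eq_moebius : ∀ i j k : ZMod 5, i ≠ j → k ≠ i + j - k → i ≠ k → j ≠ k →
    ∀ t, (swap (some i) (some j) * swap (some k) (some (i + j - k))) t =
      moebius (-2) (2 * (i + j)) 0 2 t := by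
  decide +kernel

/-- The map is `t ↦ i - (j - i) ^ 2 / (t - i)`. The factor `(j - i) ^ 3`, which is the inverse of `j
- i`, normalises the determinant to one. -/
theorem swap_none_mul_swap_eq_moebius : ∀ i j : ZMod 5, i ≠ j →
    ∀ t, (swap none (some i) * swap (some j) (some (i + i - j))) t =
      moebius (i * (j - i) ^ 3) ((-(j - i) ^ 2 - i ^ 2) * (j - i) ^ 3) ((j - i) ^ 3)
        (-i * (j - i) ^ 3) t := by
  decide +kernel

/-- The reflection of the projective line over `𝔽₅` given by `t ↦ 2u - t`. -/
def lineReflection (u : ZMod 5) : Perm (Option (ZMod 5)) :=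
  swap (some (u + 1)) (some (u - 1)) * swap (some (u + 2)) (some (u - 2))

/-- The involution `t ↦ -1 / t` of the projective line over `𝔽₅`. -/
def lineInversion : Perm (Option (ZMod 5)) :=
  swap none (some 0) * swap (some 1) (some 4)

/-- Two reflections compose to the translation by `2 * (3 * a) = a`. Lower triangular matrices are
conjugates of such translations under `t ↦ -1 / t`. -/
theorem moebius_upper : ∀ (a : ZMod 5) t,
    (lineReflection (3 * a) * lineReflection 0) t = moebius 1 a 0 1 t := by
  decide +kernel

theorem moebius_lower : ∀ (a : ZMod 5) t,
    (lineInversion * (lineReflection (-(3 * a)) * lineReflection 0) * lineInversion) t =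
      moebius 1 0 a 1 t := by
  decide +kernel

/-- The map is multiplication by `c / d = c ^ 2`, a nonzero square and so `1` or `-1`. -/
theorem moebius_diagonal : ∀ c d : ZMod 5, c * d = 1 →
    (∀ t, (1 : Perm (Option (ZMod 5))) t = moebius c 0 0 d t) ∨
      (∀ t, lineReflection 0 t = moebius c 0 0 d t) := by
  decide +kernel

variable {Ω : Type*} [DecidableEq Ω] {G : Subgroup (Perm Ω)} {f : ZMod 5 → Ω}

theorem IsPentagon.isPermIso_dihedral (hf : IsPentagon G f) (hG : NoThreeCycle G)
    (hgen : IsDoubleSwapGenerated G) (hsurj : Function.Surjective f) :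
    IsPermIso G (dihedral 5) := by
  let E := Equiv.ofBijective f ⟨hf.1, hsurj⟩
  have hE : ∀ i, f i = E i := fun _ => rfl
  have hsr : ∀ i : ZMod 5, (dihedralHom 5 (.sr i) : Perm (ZMod 5)) =
      (Equiv.addRight i).trans (Equiv.neg _) := fun i => rfl
  have hle : G ≤ (dihedral 5).comap E.symm.permCongrHom.toMonoidHom := by
    refine hgen.le fun a b c d h => ?_
    obtain ⟨i, rfl⟩ := hsurj a
    obtain ⟨j, rfl⟩ := hsurj b
    obtain ⟨k, rfl⟩ := hsurj c
    obtain ⟨m, rfl⟩ := hsurj d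
    have hs := hf.add_eq hG h
    obtain rfl : m = i + j - k := by rw [hs]; ring
    have h1 := h.1
    have hne : ∀ {x y}, f x ≠ f y → x ≠ y := fun h h' => h (congrArg f h')
    refine ⟨.sr (-(i + j)), ?_⟩
    change _ = E.symm.permCongr _
    rw [permCongr_swap_mul_swap, hsr]
    simp only [hE, symm_apply_apply]
    ext1 t
    exact (swap_mul_swap_eq_dihedral i j k (hne h1.1) (hne h1.2.2.2.2.2) (hne h1.2.1)
      (hne h1.2.2.2.1) t).symm
  have hge : ∀ g, E.permCongr (dihedralHom 5 g) ∈ G := by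
    have hr : ∀ i, E.permCongr (dihedralHom 5 (.sr i)) ∈ G := by
      intro i
      -- The reflection `t ↦ -(t + i)` fixes `2 * i`, so its 2-cycles are symmetric about that
      -- vertex.
      have key : ∀ i : ZMod 5, 1 + 2 * i ≠ -1 + 2 * i ∧ 2 + 2 * i ≠ -2 + 2 * i ∧
        1 + 2 * i ≠ 2 + 2 * i ∧ 1 + 2 * i ≠ -2 + 2 * i := by decide
      obtain ⟨h1, h2, h3, h4⟩ := key i
      have h := (hf.2 _ _ _ _ h1 h2 h3 h4 (by ring)).2
      have h5 : dihedralHom 5 (.sr i) =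
          swap (1 + 2 * i) (-1 + 2 * i) * swap (2 + 2 * i) (-2 + 2 * i) := by
        rw [hsr]
        ext1 t
        exact (dihedral_eq_swap_mul_swap i t).symm
      rw [h5, permCongr_swap_mul_swap]
      exact h
    rintro (i | i)
    · have h : DihedralGroup.r i = DihedralGroup.sr 0 * DihedralGroup.sr i := by simp
      have h1 := G.mul_mem (hr 0) (hr i)
      rw [h, map_mul]
      exact (map_mul E.permCongrHom _ _).symm ▸ h1
    · exact hr i
  refine isPermIso_of_mem_iff E.symm fun σ => ⟨fun h => hle h, ?_⟩
  rintro ⟨g, hg⟩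
  have := hge g
  rw [hg] at this
  exact (E.permCongr.apply_symm_apply σ) ▸ this

/-- Each double transposition of `G` is a Möbius map of determinant one. Conversely `SL₂(5)` is
generated by diagonal matrices and transvections, which act as products of pentagon reflections and
`t ↦ -1 / t`. -/
theorem IsPentagon.isPermIso_projSpecialLinear (hf : IsPentagon G f) (hG : NoThreeCycle G)
    (hgen : IsDoubleSwapGenerated G) {a : Ω} (ha : a ∉ Set.range f)
    (h : ∀ j k l, k ≠ l → k + l = j + j → HasDoubleSwap G a (f j) (f k) (f l))
    (hsurj : ∀ b, b ∉ Set.range f → b = a) :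
    Fintype.card (Option (ZMod 5)) = 6 ∧ Nonempty (Option (ZMod 5) ≃ Ω) ∧
      IsPermIso G (projSpecialLinear 2 (ZMod 5)) := by
  let F : Option (ZMod 5) → Ω := fun t => t.elim a f
  have hF : Function.Bijective F := by
    constructor
    · rintro (_ | s) (_ | t) hst
      · rfl
      · exact absurd ⟨t, hst.symm⟩ ha
      · exact absurd ⟨s, hst⟩ ha
      · exact congrArg some (hf.1 hst)
    · intro b
      by_cases hb : b ∈ Set.range f
      · obtain ⟨i, rfl⟩ := hb
        exact ⟨some i, rfl⟩
      · exact ⟨none, (hsurj b hb).symm⟩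
  let E := Equiv.ofBijective F hF
  let P := Equiv.ofBijective projPoint projPoint_bijective
  have hnone : a = E none := rfl
  have hsome : ∀ i, f i = E (some i) := fun _ => rfl
  have hne : ∀ {x y}, f x ≠ f y → x ≠ y := fun h h' => h (congrArg f h')
  have hmem : ∀ (τ : Perm (Option (ZMod 5))) (A : Matrix.SpecialLinearGroup (Fin 2) (ZMod 5)),
      (∀ t, τ t = moebius (A 0 0) (A 0 1) (A 1 0) (A 1 1) t) → ∀ x, P.permCongr τ x = A • x := by
    intro τ A hτ x
    obtain ⟨t, rfl⟩ := P.surjective x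
    rw [permCongr_apply, symm_apply_apply, hτ]
    exact (smul_projPoint A t).symm
  have hcongr : ∀ σ : Perm Ω, (E.symm.trans P).permCongr σ = P.permCongr (E.symm.permCongr σ) :=
    fun σ => rfl
  have hle : G ≤ (projSpecialLinear 2 (ZMod 5)).comap
      (E.symm.trans P).permCongrHom.toMonoidHom := by
    set H := (projSpecialLinear 2 (ZMod 5)).comap (E.symm.trans P).permCongrHom.toMonoidHom
    have hH : ∀ σ, (∃ A : Matrix.SpecialLinearGroup (Fin 2) (ZMod 5), ∀ t,
        E.symm.permCongr σ t = moebius (A 0 0) (A 0 1) (A 1 0) (A 1 1) t) → σ ∈ H := by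
      rintro σ ⟨A, hA⟩
      exact mem_projSpecialLinear.2 ⟨A, hmem _ A hA⟩
    have h1 : ∀ i b c, HasDoubleSwap G a (f i) b c → HasDoubleSwap H a (f i) b c := by
      intro i b c hD
      obtain ⟨j, k, rfl, rfl, hjk, hs⟩ := hf.of_cross hG hD ha
      obtain rfl : k = i + i - j := by rw [← hs]; ring
      have hij : i ≠ j := hne hD.1.2.2.2.1
      have key : ∀ i j : ZMod 5, i ≠ j → (i * (j - i) ^ 3) * (-i * (j - i) ^ 3) -
          ((-(j - i) ^ 2 - i ^ 2) * (j - i) ^ 3) * (j - i) ^ 3 = 1 := by decide +kernel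
      refine ⟨hD.1, hH _ ⟨⟨!![i * (j - i) ^ 3, (-(j - i) ^ 2 - i ^ 2) * (j - i) ^ 3;
        (j - i) ^ 3, -i * (j - i) ^ 3], ?_⟩, fun t => ?_⟩⟩
      · rw [Matrix.det_fin_two_of]
        exact key i j hij
      · rw [permCongr_swap_mul_swap]
        simp only [hnone, hsome, symm_apply_apply]
        exact swap_none_mul_swap_eq_moebius i j hij t
    have hcase : ∀ b, b = a ∨ ∃ i, b = f i := by
      intro b
      by_cases hb : b ∈ Set.range f
      · obtain ⟨i, hi⟩ := hb
        exact .inr ⟨i, hi.symm⟩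
      · exact .inl (hsurj b hb)
    have h2 : ∀ b c d, HasDoubleSwap G a b c d → HasDoubleSwap H a b c d := by
      intro b c d hD
      rcases hcase b with rfl | ⟨i, rfl⟩
      · exact absurd rfl hD.1.1
      · exact h1 i c d hD
    refine hgen.le fun b c d e hD => ?_
    rcases hcase b with rfl | ⟨i, rfl⟩
    · exact (h2 _ _ _ hD).2
    rcases hcase c with rfl | ⟨j, rfl⟩
    · exact (h2 _ _ _ hD.left).left.2
    rcases hcase d with rfl | ⟨k, rfl⟩
    · exact (h2 _ _ _ hD.symm).symm.2
    rcases hcase e with rfl | ⟨m, rfl⟩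
    · exact (h2 _ _ _ hD.symm.left).left.symm.2
    have hs := hf.add_eq hG hD
    obtain rfl : m = i + j - k := by rw [hs]; ring
    have h3 := hD.1
    refine hH _ ⟨⟨!![-2, 2 * (i + j); 0, 2], ?_⟩, fun t => ?_⟩
    · rw [Matrix.det_fin_two_of, mul_zero, sub_zero]
      decide
    · rw [permCongr_swap_mul_swap]
      simp only [hsome, symm_apply_apply]
      exact swap_mul_swap_eq_moebius i j k (hne h3.1) (hne h3.2.2.2.2.2) (hne h3.2.1)
        (hne h3.2.2.2.1) t
  have hrefl : ∀ u, E.permCongr (lineReflection u) ∈ G := by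
    intro u
    have key : ∀ u : ZMod 5, u + 1 ≠ u - 1 ∧ u + 2 ≠ u - 2 ∧ u + 1 ≠ u + 2 ∧ u + 1 ≠ u - 2 := by
      decide
    obtain ⟨h1, h2, h3, h4⟩ := key u
    rw [lineReflection, permCongr_swap_mul_swap]
    exact (hf.2 _ _ _ _ h1 h2 h3 h4 (by ring)).2
  have hinv : E.permCongr lineInversion ∈ G := by
    rw [lineInversion, permCongr_swap_mul_swap]
    exact (h 0 1 4 (by decide) (by decide)).2
  have hmul : ∀ σ τ : Perm (Option (ZMod 5)), E.permCongr σ ∈ G → E.permCongr τ ∈ G →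
      E.permCongr (σ * τ) ∈ G := by
    intro σ τ hσ hτ
    exact (map_mul E.permCongrHom σ τ).symm ▸ G.mul_mem hσ hτ
  have hge : ∀ A : Matrix.SpecialLinearGroup (Fin 2) (ZMod 5),
      ∃ τ : Perm (Option (ZMod 5)), E.permCongr τ ∈ G ∧ ∀ x, P.permCongr τ x = A • x := by
    intro A
    refine Matrix.SpecialLinearGroup.diagonal_transvection_induction'
      (fun A => ∃ τ : Perm (Option (ZMod 5)), E.permCongr τ ∈ G ∧ ∀ x, P.permCongr τ x = A • x)
      A ?_ ?_ ?_
    · intro i j hij c hc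
      have hdiag : ∀ A : Matrix.SpecialLinearGroup (Fin 2) (ZMod 5), A 0 1 = 0 → A 1 0 = 0 →
          ∃ τ : Perm (Option (ZMod 5)), E.permCongr τ ∈ G ∧ ∀ x, P.permCongr τ x = A • x := by
        intro A h1 h2
        have hdet := A.det_coe
        rw [Matrix.det_fin_two, h1, zero_mul, sub_zero] at hdet
        rcases moebius_diagonal _ _ hdet with h3 | h3
        · exact ⟨1, (map_one E.permCongrHom).symm ▸ G.one_mem, hmem _ _ (by rwa [h1, h2])⟩
        · exact ⟨lineReflection 0, hrefl 0, hmem _ _ (by rwa [h1, h2])⟩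
      apply hdiag
      · rw [Matrix.SpecialLinearGroup.diag2n_coe]; simp
      · rw [Matrix.SpecialLinearGroup.diag2n_coe]; simp
    · intro i j hij c
      obtain ⟨rfl, rfl⟩ | ⟨rfl, rfl⟩ : (i = 0 ∧ j = 1) ∨ (i = 1 ∧ j = 0) := by
        revert i j; decide
      · refine ⟨_, hmul _ _ (hrefl (3 * c)) (hrefl 0), hmem _ _ fun t => ?_⟩
        rw [moebius_upper]
        simp [Matrix.SpecialLinearGroup.transvection_coe]
      · refine ⟨_, hmul _ _ (hmul _ _ hinv (hmul _ _ (hrefl (-(3 * c))) (hrefl 0))) hinv,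
          hmem _ _ fun t => ?_⟩
        rw [moebius_lower]
        simp [Matrix.SpecialLinearGroup.transvection_coe]
    · rintro A B ⟨σ, hσ, hσ'⟩ ⟨τ, hτ, hτ'⟩
      refine ⟨σ * τ, hmul _ _ hσ hτ, fun x => ?_⟩
      have : P.permCongr (σ * τ) x = P.permCongr σ (P.permCongr τ x) := by simp
      rw [this, hσ', hτ', mul_smul]
  refine ⟨by rw [Fintype.card_option, ZMod.card], ⟨E⟩,
    isPermIso_of_mem_iff (E.symm.trans P) fun σ => ⟨fun h => hle h, fun hσ => ?_⟩⟩
  obtain ⟨A, hA⟩ := mem_projSpecialLinear.1 hσ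
  obtain ⟨τ, hτ, hτ'⟩ := hge A
  have h1 : P.permCongr (E.symm.permCongr σ) = P.permCongr τ :=
    Equiv.ext fun x => (hA x).trans (hτ' x).symm
  have h2 := P.permCongr.injective h1
  rw [← h2] at hτ
  exact (E.permCongr.apply_symm_apply σ) ▸ hτ

theorem IsPentagon.classification [Fintype Ω] (hf : IsPentagon G f) (hG : NoThreeCycle G)
    (hgen : IsDoubleSwapGenerated G) [MulAction.IsPretransitive G Ω] :
    (Fintype.card Ω = 5 ∧ IsPermIso G (dihedral 5)) ∨
      (Fintype.card Ω = 6 ∧ IsPermIso G (projSpecialLinear 2 (ZMod 5))) := by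
  by_cases hsurj : Function.Surjective f
  · refine .inl ⟨?_, hf.isPermIso_dihedral hG hgen hsurj⟩
    rw [← Fintype.card_congr (Equiv.ofBijective f ⟨hf.1, hsurj⟩), ZMod.card]
  · obtain ⟨b, hb⟩ : ∃ b, b ∉ Set.range f := by
      simpa [Function.Surjective] using hsurj
    obtain ⟨-, a, c, d, h, ⟨i, rfl⟩, ha⟩ :=
      hgen.exists_cross (s := Set.range f) ⟨0, rfl⟩ hb
    have h1 : ∀ j k l, k ≠ l → k + l = j + j → HasDoubleSwap G a (f j) (f k) (f l) :=
      fun j k l hkl hs => hf.hasDoubleSwap_infinity hG ha h.left hkl hs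
    obtain ⟨h2, ⟨E⟩, h3⟩ := hf.isPermIso_projSpecialLinear hG hgen ha h1
      fun b hb => hf.eq_infinity hG hgen ha h1 hb
    exact .inr ⟨by rw [← Fintype.card_congr E, h2], h3⟩

end Pentagon
-- Supports of double transpositions when no pentagon exists
section Support

variable {Ω : Type*} [DecidableEq Ω] {G : Subgroup (Perm Ω)} {a b c d e f g : Ω}

/-- No two double transpositions in `G` have supports that share exactly three points and generate
a dihedral group of order ten. -/
def NoPentagon (G : Subgroup (Perm Ω)) : Prop :=
  ∀ a b c d e, HasDoubleSwap G a b c d → HasDoubleSwap G a c b e → d = e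

/-- Among `a, b, c` each of the two elements contains one transposition. If these agree, a 3-cycle
appears; if they differ, a pentagon does. -/
theorem HasQuad.eq_of_share (hG : NoThreeCycle G) (hP : NoPentagon G) (h : HasQuad G a b c d)
    (h' : HasQuad G a b c e) : d = e := by
  rcases h with h | h | h <;> rcases h' with h' | h' | h'
  · exact h.not_share hG h'
  · exact hP _ _ _ _ _ h h'
  · exact hP _ _ _ _ _ h.left h'.symm
  · exact hP _ _ _ _ _ h h'
  · exact h.not_share hG h'
  · exact hP _ _ _ _ _ h.left h'.symm.left
  · exact hP _ _ _ _ _ h.symm h'.left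
  · exact hP _ _ _ _ _ h.symm.left h'.left
  · exact h.symm.not_share hG h'.symm

theorem HasQuad.not_meet_once (hG : NoThreeCycle G)
    (h : HasQuad G a b c d) (h' : HasQuad G a e f g)
    (hn : (e ≠ b ∧ e ≠ c ∧ e ≠ d) ∧ (f ≠ b ∧ f ≠ c ∧ f ≠ d) ∧ (g ≠ b ∧ g ≠ c ∧ g ≠ d)) :
    False := by
  have key : ∀ b c d, HasDoubleSwap G a b c d →
      ((e ≠ b ∧ e ≠ c ∧ e ≠ d) ∧ (f ≠ b ∧ f ≠ c ∧ f ≠ d) ∧ (g ≠ b ∧ g ≠ c ∧ g ≠ d)) → False := by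
    intro b c d h hn
    rcases h' with h' | h' | h'
    · exact HasDoubleSwap.not_meet_once hG h h' hn
    · exact HasDoubleSwap.not_meet_once hG h h' ⟨hn.2.1, hn.1, hn.2.2⟩
    · exact HasDoubleSwap.not_meet_once hG h h' ⟨hn.2.2, hn.1, hn.2.1⟩
  obtain ⟨⟨h1, h2, h3⟩, ⟨h4, h5, h6⟩, h7, h8, h9⟩ := hn
  rcases h with h | h | h
  · exact key b c d h ⟨⟨h1, h2, h3⟩, ⟨h4, h5, h6⟩, h7, h8, h9⟩
  · exact key c b d h ⟨⟨h2, h1, h3⟩, ⟨h5, h4, h6⟩, h8, h7, h9⟩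
  · exact key d b c h ⟨⟨h3, h1, h2⟩, ⟨h6, h4, h5⟩, h9, h7, h8⟩

/-- `W` is the support of a double transposition in `G`. -/
def IsQuadSupport (G : Subgroup (Perm Ω)) (W : Finset Ω) : Prop :=
  ∃ a b c d, W = {a, b, c, d} ∧ HasQuad G a b c d

theorem HasQuad.isQuadSupport (h : HasQuad G a b c d) : IsQuadSupport G {a, b, c, d} :=
  ⟨a, b, c, d, rfl, h⟩

namespace IsQuadSupport

variable {W : Finset Ω} (hW : IsQuadSupport G W)
include hW

theorem exists_eq₁ (ha : a ∈ W) : ∃ b c d, W = {a, b, c, d} ∧ HasQuad G a b c d := by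
  obtain ⟨p, q, r, s, rfl, h⟩ := hW
  simp only [Finset.mem_insert, Finset.mem_singleton] at ha
  rcases ha with rfl | rfl | rfl | rfl
  · exact ⟨q, r, s, rfl, h⟩
  · exact ⟨p, r, s, by ext; simp; tauto, h.swap12⟩
  · exact ⟨p, q, s, by ext; simp; tauto, h.swap23.swap12⟩
  · exact ⟨p, q, r, by ext; simp; tauto, h.swap34.swap23.swap12⟩

theorem exists_eq₂ (ha : a ∈ W) (hb : b ∈ W) (hab : a ≠ b) :
    ∃ c d, W = {a, b, c, d} ∧ HasQuad G a b c d := by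
  obtain ⟨q, r, s, rfl, h⟩ := hW.exists_eq₁ ha
  simp only [Finset.mem_insert, Finset.mem_singleton] at hb
  rcases hb with rfl | rfl | rfl | rfl
  · exact absurd rfl hab
  · exact ⟨r, s, rfl, h⟩
  · exact ⟨q, s, by ext; simp; tauto, h.swap23⟩
  · exact ⟨q, r, by ext; simp; tauto, h.swap34.swap23⟩

theorem exists_eq₃ (ha : a ∈ W) (hb : b ∈ W) (hc : c ∈ W) (hab : a ≠ b) (hac : a ≠ c)
    (hbc : b ≠ c) : ∃ d, W = {a, b, c, d} ∧ HasQuad G a b c d := by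
  obtain ⟨r, s, rfl, h⟩ := hW.exists_eq₂ ha hb hab
  simp only [Finset.mem_insert, Finset.mem_singleton] at hc
  rcases hc with rfl | rfl | rfl | rfl
  · exact absurd rfl hac
  · exact absurd rfl hbc
  · exact ⟨s, rfl, h⟩
  · exact ⟨r, by ext; simp; tauto, h.swap34⟩

theorem hasQuad (ha : a ∈ W) (hb : b ∈ W) (hc : c ∈ W) (hd : d ∈ W)
    (hn : a ≠ b ∧ a ≠ c ∧ a ≠ d ∧ b ≠ c ∧ b ≠ d ∧ c ≠ d) : HasQuad G a b c d := by
  obtain ⟨s, rfl, h⟩ := hW.exists_eq₃ ha hb hc hn.1 hn.2.1 hn.2.2.2.1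
  simp only [Finset.mem_insert, Finset.mem_singleton] at hd
  obtain rfl : d = s := by
    rcases hd with h | h | h | h
    · exact absurd h.symm hn.2.2.1
    · exact absurd h.symm hn.2.2.2.2.1
    · exact absurd h.symm hn.2.2.2.2.2
    · exact h
  exact h

theorem image {σ : Perm Ω} (hσ : σ ∈ G) : IsQuadSupport G (W.image σ) := by
  obtain ⟨a, b, c, d, rfl, h⟩ := hW
  exact ⟨σ a, σ b, σ c, σ d, by simp [Finset.image_insert], h.conj hσ⟩

theorem not_mem_one (hG : NoThreeCycle G) (h : HasQuad G a b c d) (ha : a ∈ W) (hb : b ∉ W)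
    (hc : c ∉ W) (hd : d ∉ W) : False := by
  obtain ⟨q, r, s, rfl, h'⟩ := hW.exists_eq₁ ha
  simp only [Finset.mem_insert, Finset.mem_singleton, not_or] at hb hc hd
  exact h'.not_meet_once hG h ⟨hb.2, hc.2, hd.2⟩

theorem mem_of_mem (hG : NoThreeCycle G) (hP : NoPentagon G) (h : HasQuad G a b c d)
    (ha : a ∈ W) (hb : b ∈ W) (hc : c ∈ W) : d ∈ W := by
  have hn := h.ne
  obtain ⟨s, rfl, h'⟩ := hW.exists_eq₃ ha hb hc hn.1 hn.2.1 hn.2.2.2.1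
  simp [h.eq_of_share hG hP h']

/-- The supports of double transpositions in `G` meet in an even number of points. -/
theorem even_meet (hG : NoThreeCycle G) (hP : NoPentagon G) (h : HasQuad G a b c d) :
    (a ∈ W ↔ b ∈ W) ↔ (c ∈ W ↔ d ∈ W) := by
  have h1 : ∀ a b c d, HasQuad G a b c d → a ∈ W → b ∉ W → c ∉ W → d ∉ W → False :=
    fun a b c d h => hW.not_mem_one hG h
  have h3 : ∀ a b c d, HasQuad G a b c d → a ∈ W → b ∈ W → c ∈ W → d ∈ W :=
    fun a b c d h => hW.mem_of_mem hG hP h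
  have p1 := h1 a b c d h
  have p2 := h1 b a c d h.swap12
  have p3 := h1 c a b d h.swap23.swap12
  have p4 := h1 d a b c h.swap34.swap23.swap12
  have q1 := h3 a b c d h
  have q2 := h3 a b d c h.swap34
  have q3 := h3 a c d b h.swap23.swap34
  have q4 := h3 b c d a h.swap12.swap23.swap34
  clear h1 h3
  by_cases ha : a ∈ W <;> by_cases hb : b ∈ W <;> by_cases hc : c ∈ W <;> by_cases hd : d ∈ W <;>
    simp_all

end IsQuadSupport
end Support

/-! ### Building the Fano plane from supports -/

section AffineConfiguration

variable {Ω : Type*} [DecidableEq Ω] {G : Subgroup (Perm Ω)}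
  {f : (Fin 3 → ZMod 2) → Ω} {U : Set (Fin 3 → ZMod 2)}

/-- The points of `U` are embedded in such a way that all affine planes contained in `U` are
supports of double transpositions in `G`. -/
def IsAffineConfiguration (G : Subgroup (Perm Ω)) (U : Set (Fin 3 → ZMod 2))
    (f : (Fin 3 → ZMod 2) → Ω) : Prop :=
  Set.InjOn f U ∧ ∀ a ∈ U, ∀ b ∈ U, ∀ c ∈ U, ∀ d ∈ U, a ≠ b → a ≠ c → b ≠ c →
    a + b + c = d → HasQuad G (f a) (f b) (f c) (f d)

theorem HasQuad.map_of_mem {a b c d a' b' c' d' : Fin 3 → ZMod 2}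
    (h : HasQuad G (f a) (f b) (f c) (f d))
    (ha : a' = a ∨ a' = b ∨ a' = c ∨ a' = d) (hb : b' = a ∨ b' = b ∨ b' = c ∨ b' = d)
    (hc : c' = a ∨ c' = b ∨ c' = c ∨ c' = d) (hd : d' = a ∨ d' = b ∨ d' = c ∨ d' = d)
    (hn : a' ≠ b' ∧ a' ≠ c' ∧ a' ≠ d' ∧ b' ≠ c' ∧ b' ≠ d' ∧ c' ≠ d') :
    HasQuad G (f a') (f b') (f c') (f d') := by
  have hne := h.ne
  have hinj : ∀ x y, (x = a ∨ x = b ∨ x = c ∨ x = d) → (y = a ∨ y = b ∨ y = c ∨ y = d) →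
      x ≠ y → f x ≠ f y := by
    rintro x y (rfl | rfl | rfl | rfl) (rfl | rfl | rfl | rfl) hxy <;>
      first
        | exact absurd rfl hxy
        | exact hne.1 | exact hne.2.1 | exact hne.2.2.1 | exact hne.2.2.2.1
        | exact hne.2.2.2.2.1 | exact hne.2.2.2.2.2
        | exact hne.1.symm | exact hne.2.1.symm | exact hne.2.2.1.symm | exact hne.2.2.2.1.symm
        | exact hne.2.2.2.2.1.symm | exact hne.2.2.2.2.2.symm
  have hmem : ∀ x, (x = a ∨ x = b ∨ x = c ∨ x = d) → f x ∈ ({f a, f b, f c, f d} : Finset Ω) := by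
    rintro x (rfl | rfl | rfl | rfl) <;> simp
  exact h.isQuadSupport.hasQuad (hmem _ ha) (hmem _ hb) (hmem _ hc) (hmem _ hd)
    ⟨hinj _ _ ha hb hn.1, hinj _ _ ha hc hn.2.1, hinj _ _ ha hd hn.2.2.1,
      hinj _ _ hb hc hn.2.2.2.1, hinj _ _ hb hd hn.2.2.2.2.1, hinj _ _ hc hd hn.2.2.2.2.2⟩

set_option synthInstance.maxSize 1000 in
set_option synthInstance.maxHeartbeats 200000 in
-- The seven planes avoiding the origin are `u ⬝ᵥ v = 1` with `u ≠ 0`, so one support for each `u`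
-- suffices. Injectivity holds because any two nonzero vectors lie in a common such plane.
theorem isAffineConfiguration_of_hasQuad
    (h : ∀ u : Fin 3 → ZMod 2, u ≠ 0 → ∃ a b c d, HasQuad G (f a) (f b) (f c) (f d) ∧
      ∀ v, u ⬝ᵥ v = 1 → (v = a ∨ v = b ∨ v = c ∨ v = d)) :
    IsAffineConfiguration G {0}ᶜ f := by
  have key : ∀ a b c : Fin 3 → ZMod 2, a ≠ 0 → b ≠ 0 → c ≠ 0 → a ≠ b → a ≠ c → b ≠ c →
      a + b + c ≠ 0 → ∃ u, u ≠ 0 ∧ u ⬝ᵥ a = 1 ∧ u ⬝ᵥ b = 1 ∧ u ⬝ᵥ c = 1 ∧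
        u ⬝ᵥ (a + b + c) = 1 ∧ a ≠ a + b + c ∧ b ≠ a + b + c ∧ c ≠ a + b + c := by
    decide +kernel
  have hquad : ∀ a b c, a ≠ 0 → b ≠ 0 → c ≠ 0 → a ≠ b → a ≠ c → b ≠ c →
      a + b + c ≠ 0 → HasQuad G (f a) (f b) (f c) (f (a + b + c)) := by
    intro a b c ha hb hc hab hac hbc hd
    obtain ⟨u, hu, h1, h2, h3, h4, h5, h6, h7⟩ := key a b c ha hb hc hab hac hbc hd
    obtain ⟨p, q, r, s, hq, hv⟩ := h u hu
    exact hq.map_of_mem (hv _ h1) (hv _ h2) (hv _ h3) (hv _ h4) ⟨hab, hac, h5, hbc, h6, h7⟩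
  refine ⟨fun a ha b hb hf => ?_, ?_⟩
  · by_contra hab
    have key : ∀ a b : Fin 3 → ZMod 2, a ≠ 0 → b ≠ 0 → a ≠ b →
      ∃ c, c ≠ 0 ∧ a ≠ c ∧ b ≠ c ∧ a + b + c ≠ 0 := by decide +kernel
    obtain ⟨c, h1, h2, h3, h4⟩ := key a b ha hb hab
    exact (hquad a b c ha hb h1 hab h2 h3 h4).ne.1 hf
  · rintro a ha b hb c hc d hd hab hac hbc rfl
    exact hquad a b c ha hb hc hab hac hbc hd

/-- Three supports of double transpositions in general position generate a Fano plane. -/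
theorem exists_isAffineConfiguration {x₁ x₂ x₃ x₄ x₅ x₆ x₇ : Ω}
    (h₁ : HasQuad G x₁ x₂ x₃ x₄) (h₂ : HasQuad G x₁ x₂ x₅ x₆) (h₃ : HasQuad G x₁ x₃ x₅ x₇)
    (h35 : x₃ ≠ x₅) (h36 : x₃ ≠ x₆) (h45 : x₄ ≠ x₅) (h46 : x₄ ≠ x₆) (h27 : x₂ ≠ x₇)
    (h47 : x₄ ≠ x₇) (h67 : x₆ ≠ x₇) : ∃ f, IsAffineConfiguration G {0}ᶜ f := by
  have n1 := h₁.ne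
  have n2 := h₂.ne
  have n3 := h₃.ne
  have h₄ : HasQuad G x₃ x₄ x₅ x₆ := h₁.symmDiff h₂ ⟨h35, h36, h45, h46⟩
  have h₅ : HasQuad G x₂ x₄ x₅ x₇ :=
    h₁.swap23.symmDiff h₃ ⟨n2.2.2.2.1, h27, h45, h47⟩
  have h₆ : HasQuad G x₂ x₆ x₃ x₇ :=
    h₂.swap23.symmDiff h₃.swap23 ⟨n1.2.2.2.1, h27, h36.symm, h67⟩
  have h₇ : HasQuad G x₄ x₆ x₁ x₇ :=
    h₄.swap23.symmDiff h₃.swap12.swap23 ⟨n1.2.2.1.symm, h47, n2.2.2.1.symm, h67⟩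
  -- `x₁, …, x₇` receive the binary labels `111, 110, …, 001`. The value at the origin is a dummy.
  let f : (Fin 3 → ZMod 2) → Ω := fun v =>
    (![![![x₁, x₇], ![x₆, x₅]], ![![x₄, x₃], ![x₂, x₁]]] : Fin 2 → Fin 2 → Fin 2 → Ω)
      (v 0) (v 1) (v 2)
  refine ⟨f, isAffineConfiguration_of_hasQuad fun u hu => ?_⟩
  have hcases : ∀ u : Fin 3 → ZMod 2, u ≠ 0 → u = ![1, 0, 0] ∨ u = ![0, 1, 0] ∨ u = ![0, 0, 1] ∨
      u = ![1, 1, 0] ∨ u = ![1, 0, 1] ∨ u = ![0, 1, 1] ∨ u = ![1, 1, 1] := by decide +kernel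
  rcases hcases u hu with rfl | rfl | rfl | rfl | rfl | rfl | rfl
  · exact ⟨![1, 1, 1], ![1, 1, 0], ![1, 0, 1], ![1, 0, 0], h₁, by decide +kernel⟩
  · exact ⟨![1, 1, 1], ![1, 1, 0], ![0, 1, 1], ![0, 1, 0], h₂, by decide +kernel⟩
  · exact ⟨![1, 1, 1], ![1, 0, 1], ![0, 1, 1], ![0, 0, 1], h₃, by decide +kernel⟩
  · exact ⟨![1, 0, 1], ![1, 0, 0], ![0, 1, 1], ![0, 1, 0], h₄, by decide +kernel⟩
  · exact ⟨![1, 1, 0], ![1, 0, 0], ![0, 1, 1], ![0, 0, 1], h₅, by decide +kernel⟩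
  · exact ⟨![1, 1, 0], ![0, 1, 0], ![1, 0, 1], ![0, 0, 1], h₆, by decide +kernel⟩
  · exact ⟨![1, 0, 0], ![0, 1, 0], ![1, 1, 1], ![0, 0, 1], h₇, by decide +kernel⟩

end AffineConfiguration
-- Primitivity provides three supports in general position
section Primitive

variable {Ω : Type*} [DecidableEq Ω] {G : Subgroup (Perm Ω)}

theorem swap_mul_swap_comm_fin_four : ∀ a b c d t : Fin 4,
    (a ≠ b ∧ a ≠ c ∧ a ≠ d ∧ b ≠ c ∧ b ≠ d ∧ c ≠ d) →
    (swap a b * swap c d) ((swap 0 1 * swap 2 3 : Perm (Fin 4)) t) =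
      (swap 0 1 * swap 2 3 : Perm (Fin 4)) ((swap a b * swap c d) t) := by
  decide +kernel

/-- The group generated by the double transpositions of four points is imprimitive. -/
theorem exists_notMem_of_isPreprimitive (hgen : IsDoubleSwapGenerated G)
    [MulAction.IsPreprimitive G Ω] {a b c d : Ω} (h : HasDoubleSwap G a b c d) :
    ∃ x, x ≠ a ∧ x ≠ b ∧ x ≠ c ∧ x ≠ d := by
  by_contra! hcon
  let φ : Fin 4 → Ω := ![a, b, c, d]
  have hn := h.1
  have hφ : Function.Injective φ := by
    intro i j hij
    fin_cases i <;> fin_cases j <;> simp [φ] at hij <;> simp_all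
  have hsurj : Function.Surjective φ := by
    intro x
    by_cases ha : x = a
    · exact ⟨0, ha.symm⟩
    by_cases hb : x = b
    · exact ⟨1, hb.symm⟩
    by_cases hc : x = c
    · exact ⟨2, hc.symm⟩
    exact ⟨3, (hcon x ha hb hc).symm⟩
  have hswap : ∀ i j k m t, (swap (φ i) (φ j) * swap (φ k) (φ m)) (φ t) =
      φ ((swap i j * swap k m) t) := by
    intro i j k m t
    simp only [Perm.mul_apply, hφ.swap_apply]
  have hle : G ≤ Subgroup.centralizer {swap a b * swap c d} := by
    refine hgen.le fun p q r s h' => ?_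
    obtain ⟨i, rfl⟩ := hsurj p
    obtain ⟨j, rfl⟩ := hsurj q
    obtain ⟨k, rfl⟩ := hsurj r
    obtain ⟨m, rfl⟩ := hsurj s
    have hne : ∀ {x y}, φ x ≠ φ y → x ≠ y := fun h h' => h (congrArg φ h')
    have hn' := h'.1
    rw [Subgroup.mem_centralizer_singleton_iff]
    ext x
    obtain ⟨t, rfl⟩ := hsurj x
    change (swap (φ i) (φ j) * swap (φ k) (φ m)) ((swap (φ 0) (φ 1) * swap (φ 2) (φ 3)) (φ t)) =
      (swap (φ 0) (φ 1) * swap (φ 2) (φ 3)) ((swap (φ i) (φ j) * swap (φ k) (φ m)) (φ t))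
    rw [hswap, hswap, hswap, hswap, swap_mul_swap_comm_fin_four i j k m t
      ⟨hne hn'.1, hne hn'.2.1, hne hn'.2.2.1, hne hn'.2.2.2.1, hne hn'.2.2.2.2.1,
        hne hn'.2.2.2.2.2⟩]
  have hcomm : ∀ σ ∈ G, ∀ x, σ ((swap a b * swap c d) x) = (swap a b * swap c d) (σ x) := by
    intro σ hσ x
    exact Perm.ext_iff.1 (Subgroup.mem_centralizer_singleton_iff.1 (hle hσ)) x
  have hinv : ∀ x, (swap a b * swap c d) ((swap a b * swap c d) x) = x := by
    intro x
    by_cases ha : x = a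
    · rw [ha, h.map₁, h.map₂]
    by_cases hb : x = b
    · rw [hb, h.map₂, h.map₁]
    by_cases hc : x = c
    · rw [hc, h.map₃, h.map₄]
    rw [hcon x ha hb hc, h.map₄, h.map₃]
  let r : Setoid Ω :=
    { r := fun x y => y = x ∨ y = (swap a b * swap c d) x
      iseqv := by
        refine ⟨fun x => .inl rfl, ?_, ?_⟩
        · rintro x y (rfl | rfl)
          · exact .inl rfl
          · exact .inr (hinv x).symm
        · rintro x y z (rfl | rfl) (rfl | rfl)
          · exact .inl rfl
          · exact .inr rfl
          · exact .inr rfl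
          · exact .inl (hinv x) }
  refine hn.1 (eq_of_isPreprimitive (G := G) r (fun σ hσ x y hxy => ?_)
    (x := a) (y := b) (z := c) (.inr h.map₁.symm) ?_)
  · rcases hxy with rfl | rfl
    · exact .inl rfl
    · exact .inr (hcomm σ hσ x)
  · rintro (h1 | h1)
    · exact hn.2.1 h1.symm
    · rw [h.map₁] at h1
      exact hn.2.2.2.1 h1.symm

/-- Lying in the same supports is a `G`-invariant relation. The support `Y` shows that it is not
universal, so by primitivity it is equality. -/
theorem exists_isQuadSupport_separating [MulAction.IsPreprimitive G Ω] {x y z : Ω} (hxy : x ≠ y)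
    {Y : Finset Ω} (hY : IsQuadSupport G Y) (hYxz : ¬ (x ∈ Y ↔ z ∈ Y)) :
    ∃ W, IsQuadSupport G W ∧ ¬ (x ∈ W ↔ y ∈ W) := by
  by_contra! hcon
  let r : Setoid Ω :=
    { r := fun x y => ∀ W, IsQuadSupport G W → (x ∈ W ↔ y ∈ W)
      iseqv := ⟨fun _ _ _ => Iff.rfl, fun h W hW => (h W hW).symm,
        fun h h' W hW => (h W hW).trans (h' W hW)⟩ }
  refine hxy (eq_of_isPreprimitive (G := G) r (fun σ hσ u v huv W hW => ?_) hcon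
    fun h => hYxz (h Y hY))
  have h1 : ∀ t, t ∈ W.image (σ⁻¹ : Perm Ω) ↔ σ t ∈ W := by
    intro t
    rw [Finset.mem_image]
    constructor
    · rintro ⟨w, hw, rfl⟩
      simpa using hw
    · intro ht
      exact ⟨_, ht, by simp⟩
  rw [← h1, ← h1]
  exact huv _ (hW.image (G.inv_mem hσ))

theorem exists_isAffineConfiguration_of_isPreprimitive (hG : NoThreeCycle G) (hP : NoPentagon G)
    (hgen : IsDoubleSwapGenerated G) [MulAction.IsPreprimitive G Ω] [Nontrivial Ω] :
    ∃ f, IsAffineConfiguration G {0}ᶜ f := by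
  obtain ⟨x, y, hxy⟩ := exists_pair_ne Ω
  obtain ⟨a, b, c, d, hD, -, -⟩ :=
    hgen.exists_cross (s := {x}) (Set.mem_singleton x) (y := y) hxy.symm
  obtain ⟨w, hw⟩ := exists_notMem_of_isPreprimitive hgen hD
  obtain ⟨p, q, r, s, hD', hp, hq⟩ := hgen.exists_cross (s := {x | x = a ∨ x = b ∨ x = c ∨ x = d})
    (x := a) (.inl rfl) (y := w) (by simpa using hw)
  have hX : HasQuad G a b c d := .inl hD
  generalize hXdef : ({a, b, c, d} : Finset Ω) = X at *
  have hXs : IsQuadSupport G X := hXdef ▸ hX.isQuadSupport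
  have hpX : p ∈ X := by rw [← hXdef]; simpa using hp
  have hqX : q ∉ X := by rw [← hXdef]; simpa using hq
  have hQ : HasQuad G p q r s := .inl hD'
  -- two supports meeting in exactly two points
  obtain ⟨x₁, x₂, x₃, x₄, x₅, x₆, h₁, h₂, hX', h5, h6⟩ : ∃ x₁ x₂ x₃ x₄ x₅ x₆,
      HasQuad G x₁ x₂ x₃ x₄ ∧ HasQuad G x₁ x₂ x₅ x₆ ∧ X = {x₁, x₂, x₃, x₄} ∧ x₅ ∉ X ∧ x₆ ∉ X := by
    -- As `p ∈ X` and `q ∉ X`, parity puts exactly one of `r`, `s` into `X`.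
    have hpar := not_iff.1 fun h => hqX (((hXs.even_meet hG hP hQ).2 h).1 hpX)
    have hn := hQ.ne
    by_cases hr : r ∈ X
    · have hs : s ∉ X := fun h => hpar.2 h hr
      obtain ⟨u, v, hX', h1⟩ := hXs.exists_eq₂ hpX hr hn.2.1
      exact ⟨p, r, u, v, q, s, h1, hQ.swap23, hX', hqX, hs⟩
    · have hs : s ∈ X := hpar.1 hr
      obtain ⟨u, v, hX', h1⟩ := hXs.exists_eq₂ hpX hs hn.2.2.1
      exact ⟨p, s, u, v, q, r, h1, hQ.swap34.swap23, hX', hqX, hr⟩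
  clear hXdef hpX hqX hQ
  subst hX'
  simp only [Finset.mem_insert, Finset.mem_singleton, not_or] at h5 h6
  have n1 := h₁.ne
  have n2 := h₂.ne
  obtain ⟨W, hW, hsep⟩ := exists_isQuadSupport_separating (G := G) (x := x₁) (y := x₂) (z := x₃)
    n1.1 h₂.isQuadSupport (by
      simp only [Finset.mem_insert, Finset.mem_singleton, true_or, true_iff]
      rintro (h | h | h | h)
      · exact n1.2.1 h.symm
      · exact n1.2.2.2.1 h.symm
      · exact h5.2.2.1 h.symm
      · exact h6.2.2.1 h.symm)
  have key : ∀ x₁ x₂ x₃ x₄ x₅ x₆, HasQuad G x₁ x₂ x₃ x₄ → HasQuad G x₁ x₂ x₅ x₆ →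
      (x₅ ≠ x₃ ∧ x₅ ≠ x₄ ∧ x₆ ≠ x₃ ∧ x₆ ≠ x₄) → x₁ ∈ W → x₂ ∉ W → x₃ ∈ W → x₄ ∉ W → x₅ ∈ W →
      x₆ ∉ W → ∃ f, IsAffineConfiguration G {0}ᶜ f := by
    intro x₁ x₂ x₃ x₄ x₅ x₆ h₁ h₂ hn m1 m2 m3 m4 m5 m6
    obtain ⟨x₇, rfl, h₃⟩ := hW.exists_eq₃ m1 m3 m5 h₁.ne.2.1 h₂.ne.2.1 hn.1.symm
    simp only [Finset.mem_insert, Finset.mem_singleton, not_or] at m2 m4 m6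
    exact exists_isAffineConfiguration h₁ h₂ h₃ hn.1.symm hn.2.2.1.symm hn.2.1.symm
      hn.2.2.2.symm m2.2.2.2 m4.2.2.2 m6.2.2.2
  -- Since `W` separates `x₁` from `x₂`, parity makes it contain exactly one of `x₃, x₄` and one of
  -- `x₅, x₆`. After relabelling, `W` is `{x₁, x₃, x₅, x₇}`.
  have key2 : ∀ x₁ x₂, HasQuad G x₁ x₂ x₃ x₄ → HasQuad G x₁ x₂ x₅ x₆ → x₁ ∈ W → x₂ ∉ W →
      ∃ f, IsAffineConfiguration G {0}ᶜ f := by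
    intro x₁ x₂ h₁ h₂ m1 m2
    have e1 := not_iff.1 fun h => m2 (((hW.even_meet hG hP h₁).2 h).1 m1)
    have e2 := not_iff.1 fun h => m2 (((hW.even_meet hG hP h₂).2 h).1 m1)
    by_cases m3 : x₃ ∈ W <;> by_cases m5 : x₅ ∈ W
    · exact key x₁ x₂ x₃ x₄ x₅ x₆ h₁ h₂ ⟨h5.2.2.1, h5.2.2.2, h6.2.2.1, h6.2.2.2⟩ m1 m2 m3
        (fun h => e1.2 h m3) m5 (fun h => e2.2 h m5)
    · exact key x₁ x₂ x₃ x₄ x₆ x₅ h₁ h₂.swap34 ⟨h6.2.2.1, h6.2.2.2, h5.2.2.1, h5.2.2.2⟩ m1 m2 m3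
        (fun h => e1.2 h m3) (e2.1 m5) m5
    · exact key x₁ x₂ x₄ x₃ x₅ x₆ h₁.swap34 h₂ ⟨h5.2.2.2, h5.2.2.1, h6.2.2.2, h6.2.2.1⟩ m1 m2
        (e1.1 m3) m3 m5 (fun h => e2.2 h m5)
    · exact key x₁ x₂ x₄ x₃ x₆ x₅ h₁.swap34 h₂.swap34 ⟨h6.2.2.2, h6.2.2.1, h5.2.2.2, h5.2.2.1⟩
        m1 m2 (e1.1 m3) m3 (e2.1 m5) m5
  by_cases m1 : x₁ ∈ W
  · exact key2 x₁ x₂ h₁ h₂ m1 fun h => hsep ⟨fun _ => h, fun _ => m1⟩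
  · exact key2 x₂ x₁ h₁.swap12 h₂.swap12 ((not_iff.1 hsep).1 m1) m1

end Primitive
-- Adding the origin as an eighth point
section AffineConfiguration

theorem two_eq_zero_vector : (2 : Fin 3 → ZMod 2) = 0 := by decide

/-- The sets of vectors that carry a configuration: all vectors, or all nonzero vectors. -/
def IsPuncturedOrFull (U : Set (Fin 3 → ZMod 2)) : Prop :=
  U = {0}ᶜ ∨ U = Set.univ

variable {Ω : Type*} [DecidableEq Ω] {G : Subgroup (Perm Ω)}
  {f : (Fin 3 → ZMod 2) → Ω} {U : Set (Fin 3 → ZMod 2)}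

theorem IsPuncturedOrFull.mem_of_ne (hU : IsPuncturedOrFull U) {v : Fin 3 → ZMod 2}
    (hv : v ≠ 0) : v ∈ U := by
  rcases hU with rfl | rfl
  · exact hv
  · trivial

set_option synthInstance.maxSize 1000 in
set_option synthInstance.maxHeartbeats 200000 in
theorem IsPuncturedOrFull.exists_plane (hU : IsPuncturedOrFull U) (a b : Fin 3 → ZMod 2) : ∃ c ∈ U, ∃ d ∈ U, ∃ e ∈ U, a ≠ c ∧ a ≠ d ∧ c ≠ d ∧
      a + c + d = e ∧ (a ≠ b → b ≠ c ∧ b ≠ d ∧ b ≠ e) := by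
  have key : ∀ a b : Fin 3 → ZMod 2, ∃ c d, c ≠ 0 ∧ d ≠ 0 ∧ a + c + d ≠ 0 ∧
      (a ≠ c ∧ a ≠ d ∧ c ≠ d) ∧ (a ≠ b → b ≠ c ∧ b ≠ d ∧ b ≠ a + c + d) := by
    decide +kernel
  obtain ⟨c, d, h1, h2, h3, ⟨h4, h5, h6⟩, h7⟩ := key a b
  exact ⟨c, hU.mem_of_ne h1, d, hU.mem_of_ne h2, _, hU.mem_of_ne h3, h4, h5, h6, rfl, h7⟩

theorem IsPuncturedOrFull.add_mem_or (hU : IsPuncturedOrFull U) {a b c d : Fin 3 → ZMod 2}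
    (hcd : c ≠ d) : a + b + c ∈ U ∨ a + b + d ∈ U := by
  by_cases h : a + b + c = 0
  · by_cases h' : a + b + d = 0
    · exact absurd (add_left_cancel (h.trans h'.symm)) hcd
    · exact .inr (hU.mem_of_ne h')
  · exact .inl (hU.mem_of_ne h)

namespace IsAffineConfiguration

variable (hG : NoThreeCycle G) (hP : NoPentagon G) (hf : IsAffineConfiguration G U f)
include hG hP hf

/-- If `W` contained at most one configuration point besides `f a`, a plane through `a` avoiding
that point would meet `W` once. If `a + b + c` were in `U`, the plane of `a, b, c` would share three
points with `W` and so equal it. -/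
theorem exists_of_cross (hU : IsPuncturedOrFull U) {W : Finset Ω} (hW : IsQuadSupport G W) {q : Ω}
    (hqW : q ∈ W) (hq : q ∉ f '' U) {a : Fin 3 → ZMod 2} (ha : a ∈ U) (haW : f a ∈ W) :
    ∃ b ∈ U, ∃ c ∈ U, a ≠ b ∧ a ≠ c ∧ b ≠ c ∧ a + b + c ∉ U ∧ HasQuad G q (f a) (f b) (f c) := by
  have hne : ∀ {x y}, y ∈ U → x ∉ f '' U → f y ≠ x := fun hy hx h => hx ⟨_, hy, h⟩
  obtain ⟨r, s, rfl, hQ⟩ := hW.exists_eq₂ hqW haW (hne ha hq).symm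
  have hnot : ∀ b, (∀ y ∈ U, b ≠ y → f y ≠ r ∧ f y ≠ s) → a ≠ b → False := by
    intro b hb hab
    obtain ⟨c, hc, d, hd, e, he, h1, h2, h3, h4, h5⟩ := hU.exists_plane a b
    obtain ⟨h5, h6, h7⟩ := h5 hab
    have hq' := hf.2 a ha c hc d hd e he h1 h2 h3 h4
    have hn := hq'.ne
    refine hW.not_mem_one hG hq' haW ?_ ?_ ?_ <;>
      simp only [Finset.mem_insert, Finset.mem_singleton, not_or]
    · exact ⟨hne hc hq, hn.1.symm, hb c hc h5⟩
    · exact ⟨hne hd hq, hn.2.1.symm, hb d hd h6⟩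
    · exact ⟨hne he hq, hn.2.2.1.symm, hb e he h7⟩
  by_cases hr : r ∈ f '' U
  · obtain ⟨b, hb, rfl⟩ := hr
    have hab : a ≠ b := fun h => hQ.ne.2.2.2.1 (congrArg f h)
    by_cases hs : s ∈ f '' U
    · obtain ⟨c, hc, rfl⟩ := hs
      have hac : a ≠ c := fun h => hQ.ne.2.2.2.2.1 (congrArg f h)
      have hbc : b ≠ c := fun h => hQ.ne.2.2.2.2.2 (congrArg f h)
      refine ⟨b, hb, c, hc, hab, hac, hbc, fun hd => ?_, hQ⟩
      have hq' := hf.2 a ha b hb c hc _ hd hab hac hbc rfl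
      have hn := hq'.ne
      have hmem := hW.mem_of_mem hG hP hq' haW (by simp) (by simp)
      simp only [Finset.mem_insert, Finset.mem_singleton] at hmem
      rcases hmem with h | h | h | h
      · exact hne hd hq h
      · exact hn.2.2.1 h.symm
      · exact hn.2.2.2.2.1 h.symm
      · exact hn.2.2.2.2.2 h.symm
    · exact (hnot b (fun y hy hby => ⟨fun h => hby (hf.1 hb hy h.symm), hne hy hs⟩) hab).elim
  · by_cases hs : s ∈ f '' U
    · obtain ⟨b, hb, rfl⟩ := hs
      have hab : a ≠ b := fun h => hQ.ne.2.2.2.2.1 (congrArg f h)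
      exact (hnot b (fun y hy hby => ⟨hne hy hr, fun h => hby (hf.1 hb hy h.symm)⟩) hab).elim
    · have key : ∀ a : Fin 3 → ZMod 2, a ≠ a + 1 := by decide
      exact (hnot (a + 1) (fun y hy _ => ⟨hne hy hr, hne hy hs⟩) (key a)).elim

omit hG hP in
set_option synthInstance.maxSize 1000 in
set_option synthInstance.maxHeartbeats 200000 in
/-- A single plane through a new point extends a configuration on the nonzero vectors. -/
theorem extend (hU : U = {0}ᶜ) {q : Ω} (hq : q ∉ f '' U) {a b : Fin 3 → ZMod 2} (ha : a ≠ 0)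
    (hb : b ≠ 0) (hab : a ≠ b) (h : HasQuad G q (f a) (f b) (f (a + b))) :
    IsAffineConfiguration G Set.univ (Function.update f 0 q) := by
  subst hU
  have h2 := two_eq_zero_vector
  have hqf : ∀ v, v ≠ 0 → q ≠ f v := fun v hv h => hq ⟨v, hv, h.symm⟩
  have hsymm : ∀ x y, HasQuad G q (f x) (f y) (f (x + y)) →
      HasQuad G q (f y) (f x) (f (y + x)) := fun x y h => add_comm x y ▸ h.swap23
  have hadd : ∀ x y, HasQuad G q (f x) (f y) (f (x + y)) →
      HasQuad G q (f x) (f (x + y)) (f (x + (x + y))) := by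
    intro x y h
    have : x + (x + y) = y := by linear_combination x * h2
    rw [this]
    exact h.swap34
  -- The symmetric difference with the plane `{y, x + y, z, x + z}` replaces `y` by `z`: all lines
  -- of the Fano plane through `x` are obtained.
  have hstep : ∀ x y, x ≠ 0 → y ≠ 0 → x ≠ y → HasQuad G q (f x) (f y) (f (x + y)) →
      ∀ z, z ≠ 0 → z ≠ x → HasQuad G q (f x) (f z) (f (x + z)) := by
    intro x y hx hy hxy h z hz hzx
    by_cases hzy : z = y
    · exact hzy ▸ h
    by_cases hzxy : z = x + y
    · exact hzxy ▸ hadd x y h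
    have key : ∀ x y z : Fin 3 → ZMod 2, x ≠ 0 → y ≠ 0 → x ≠ y → z ≠ 0 → z ≠ x → z ≠ y →
        z ≠ x + y → x + y ≠ 0 ∧ x + z ≠ 0 ∧ y ≠ x + y ∧ x + y ≠ z ∧ x ≠ x + z := by
      decide +kernel
    obtain ⟨h3, h4, h5, h6, h7⟩ := key x y z hx hy hxy hz hzx hzy hzxy
    have h8 := hf.2 y hy (x + y) h3 z hz (x + z) h4 h5 (Ne.symm hzy) h6
      (by linear_combination y * h2)
    have h9 : HasQuad G (f y) (f (x + y)) q (f x) := h.swap23.swap34.swap12.swap23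
    exact h9.symmDiff h8 ⟨hqf z hz, hqf _ h4, fun h => hzx (hf.1 hz hx h.symm),
      fun h => h7 (hf.1 hx h4 h)⟩
  have hab0 : a + b ≠ 0 := fun h => hab (by linear_combination h - b * h2)
  have hM : ∀ p, (p = a ∨ p = b ∨ p = a + b) → p ≠ 0 ∧
      ∀ z, z ≠ 0 → z ≠ p → HasQuad G q (f p) (f z) (f (p + z)) := by
    rintro p (rfl | rfl | rfl)
    · exact ⟨ha, hstep _ _ ha hb hab h⟩
    · exact ⟨hb, hstep _ _ hb ha hab.symm (hsymm _ _ h)⟩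
    · exact ⟨hab0, hstep _ _ hab0 ha (fun h => hb (by linear_combination h))
        (hsymm _ _ (hadd _ _ h))⟩
  have hall : ∀ x y, x ≠ 0 → y ≠ 0 → x ≠ y → HasQuad G q (f x) (f y) (f (x + y)) := by
    intro x y hx hy hxy
    -- Two lines of the Fano plane meet, so any line is reached through a point of the given one.
    have key : ∀ a b : Fin 3 → ZMod 2, a ≠ 0 → b ≠ 0 → a ≠ b → ∀ x y, x ≠ 0 → y ≠ 0 → x ≠ y →
        ∃ p, (p = a ∨ p = b ∨ p = a + b) ∧ (p = x ∨ p = y ∨ p = x + y) := by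
      decide +kernel
    obtain ⟨p, hp, hp'⟩ := key a b ha hb hab x y hx hy hxy
    obtain ⟨h3, h4⟩ := hM p hp
    rcases hp' with rfl | rfl | rfl
    · exact h4 y hy hxy.symm
    · exact hsymm _ _ (h4 x hx hxy)
    · have h5 := hadd _ _ (hsymm _ _ (h4 x hx fun h => hy (by linear_combination -h)))
      have h6 : x + (x + y) = y := by linear_combination x * h2
      rwa [h6] at h5
  have hg0 : Function.update f 0 q 0 = q := Function.update_self ..
  have hg : ∀ {v}, v ≠ 0 → Function.update f 0 q v = f v := fun h => Function.update_of_ne h ..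
  refine ⟨fun x _ y _ hxy => ?_, fun x _ y _ z _ w _ hxy hxz hyz hs => ?_⟩
  · by_cases hx : x = 0 <;> by_cases hy : y = 0
    · rw [hx, hy]
    · rw [hx, hg0, hg hy] at hxy
      exact absurd hxy (hqf y hy)
    · rw [hy, hg0, hg hx] at hxy
      exact absurd hxy.symm (hqf x hx)
    · rw [hg hx, hg hy] at hxy
      exact hf.1 hx hy hxy
  · by_cases hx : x = 0
    · subst hx
      rw [zero_add] at hs
      rw [hg0, hg hxy.symm, hg hxz.symm, ← hs]
      have hw : y + z ≠ 0 := fun h => hyz (by linear_combination h - z * h2)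
      rw [hg hw]
      exact hall y z hxy.symm hxz.symm hyz
    by_cases hy : y = 0
    · subst hy
      rw [add_zero] at hs
      have hw : x + z ≠ 0 := fun h => hxz (by linear_combination h - z * h2)
      rw [hg0, hg hx, hg hyz.symm, ← hs, hg hw]
      exact (hall x z hx hyz.symm hxz).swap12
    by_cases hz : z = 0
    · subst hz
      rw [add_zero] at hs
      have hw : x + y ≠ 0 := fun h => hxy (by linear_combination h - y * h2)
      rw [hg0, hg hx, hg hy, ← hs, hg hw]
      exact (hall x y hx hy hxy).swap12.swap23
    by_cases hw : w = 0
    · subst hw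
      have hz' : z = x + y := by linear_combination hs - (x + y) * h2
      subst hz'
      rw [hg0, hg hx, hg hy, hg hz]
      exact (hall x y hx hy hxy).swap12.swap23.swap34
    · rw [hg hx, hg hy, hg hz, hg hw]
      exact hf.2 x hx y hy z hz w hw hxy hxz hyz hs

/-- A support leaving the configuration yields three vectors whose sum lies outside `U`. For nonzero
vectors that sum is `0`, and `extend` applies; once the origin is included it is impossible. -/
theorem exists_surjOn [MulAction.IsPretransitive G Ω] (hgen : IsDoubleSwapGenerated G)
    (hU : U = {0}ᶜ) :
    f '' U = Set.univ ∨ ∃ g, IsAffineConfiguration G Set.univ g ∧ g '' Set.univ = Set.univ := by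
  subst hU
  have h2 := two_eq_zero_vector
  have hcross : ∀ (U : Set (Fin 3 → ZMod 2)) (f : (Fin 3 → ZMod 2) → Ω), IsPuncturedOrFull U →
      IsAffineConfiguration G U f → ∀ w, w ∉ f '' U → ∃ q ∉ f '' U, ∃ a ∈ U, ∃ b ∈ U, ∃ c ∈ U,
        a ≠ b ∧ a ≠ c ∧ b ≠ c ∧ a + b + c ∉ U ∧ HasQuad G q (f a) (f b) (f c) := by
    intro U f hU hf w hw
    have h1 : (1 : Fin 3 → ZMod 2) ∈ U := hU.mem_of_ne (by decide)
    obtain ⟨p, q, r, s, hD, ⟨a, ha, rfl⟩, hq⟩ :=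
      hgen.exists_cross (s := f '' U) ⟨_, h1, rfl⟩ hw
    have hQ : HasQuad G (f a) q r s := .inl hD
    obtain ⟨b, hb, c, hc, h⟩ :=
      hf.exists_of_cross hG hP hU hQ.isQuadSupport (q := q) (by simp) hq ha (by simp)
    exact ⟨q, hq, a, ha, b, hb, c, hc, h⟩
  by_cases hsurj : f '' {0}ᶜ = Set.univ
  · exact .inl hsurj
  · obtain ⟨w, hw⟩ := (Set.ne_univ_iff_exists_notMem _).1 hsurj
    obtain ⟨q, hq, a, ha, b, hb, c, hc, hab, hac, hbc, hs, hQ⟩ := hcross _ f (.inl rfl) hf w hw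
    have hs' : a + b + c = 0 := by simpa using hs
    have hc' : c = a + b := by linear_combination hs' - (a + b) * h2
    subst hc'
    have hg := hf.extend rfl hq ha hb hab hQ
    refine .inr ⟨_, hg, ?_⟩
    by_contra hsurj'
    obtain ⟨w, hw⟩ := (Set.ne_univ_iff_exists_notMem _).1 hsurj'
    obtain ⟨q, hq, a, ha, b, hb, c, hc, -, -, -, hs, -⟩ := hcross _ _ (.inr rfl) hg w hw
    exact hs trivial

end IsAffineConfiguration
end AffineConfiguration
-- Directions of double transpositions
section Direction

variable {Ω : Type*} [DecidableEq Ω] {G : Subgroup (Perm Ω)}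
  {f : (Fin 3 → ZMod 2) → Ω} {U : Set (Fin 3 → ZMod 2)}

/-- All pairs of disjoint edges in the direction `u` are interchanged by double transpositions
in `G`. -/
def IsSwapDirection (G : Subgroup (Perm Ω)) (U : Set (Fin 3 → ZMod 2))
    (f : (Fin 3 → ZMod 2) → Ω) (u : Fin 3 → ZMod 2) : Prop :=
  u ≠ 0 ∧ ∀ x ∈ U, ∀ y ∈ U, ∀ z ∈ U, ∀ w ∈ U, x + y = u → z + w = u → x ≠ z → x ≠ w →
    HasDoubleSwap G (f x) (f y) (f z) (f w)

namespace IsAffineConfiguration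

variable (hG : NoThreeCycle G) (hP : NoPentagon G) (hf : IsAffineConfiguration G U f)
  (hU : IsPuncturedOrFull U) {a b c d : Fin 3 → ZMod 2}
include hG hP hf hU

/-- At least one of `a + b + c` and `a + b + d` lies in `U`, and the plane through it shares three
points with the given support. -/
theorem add_eq (ha : a ∈ U) (hb : b ∈ U) (hc : c ∈ U) (hd : d ∈ U)
    (h : HasQuad G (f a) (f b) (f c) (f d)) : a + b + c = d := by
  obtain ⟨h1, h2, h3, h4, h5, h6⟩ := h.ne
  have ne : ∀ {x y}, f x ≠ f y → x ≠ y := fun h h' => h (congrArg f h')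
  rcases hU.add_mem_or (a := a) (b := b) (ne h6) with h7 | h7
  · exact hf.1 h7 hd
      ((hf.2 a ha b hb c hc _ h7 (ne h1) (ne h2) (ne h4) rfl).eq_of_share hG hP h)
  · have h8 := hf.1 h7 hc
      ((hf.2 a ha b hb d hd _ h7 (ne h1) (ne h3) (ne h5) rfl).eq_of_share hG hP h.swap34)
    linear_combination -h8 + (a + b) * two_eq_zero_vector

omit hG hP hU in
theorem hasDoubleSwap_of_add_eq {x y : Fin 3 → ZMod 2} (ha : a ∈ U) (hb : b ∈ U) (hc : c ∈ U)
    (hd : d ∈ U) (hx : x ∈ U) (hy : y ∈ U) (h : HasDoubleSwap G (f a) (f b) (f c) (f d))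
    (hcd : c + d = a + b) (hxy : x + y = a + b) (hxa : x ≠ a) (hxb : x ≠ b) :
    HasDoubleSwap G (f a) (f b) (f x) (f y) := by
  have h2 := two_eq_zero_vector
  by_cases hxc : x = c
  · subst hxc
    rwa [add_left_cancel (hxy.trans hcd.symm)]
  by_cases hxd : x = d
  · subst hxd
    rw [add_left_cancel ((hxy.trans hcd.symm).trans (add_comm _ _))]
    exact h.right
  have hab : a ≠ b := fun h' => h.1.1 (congrArg f h')
  have hyc : c ≠ y := fun h => hxd (by linear_combination hxy - hcd + h)
  have hyd : d ≠ y := fun h => hxc (by linear_combination hxy - hcd + h)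
  have hinj : ∀ {x y}, x ∈ U → y ∈ U → x ≠ y → f x ≠ f y := fun hx hy h h' => h (hf.1 hx hy h')
  exact h.transfer (hf.2 a ha b hb x hx y hy hab hxa.symm hxb.symm
      (by linear_combination -hxy + x * h2))
    ⟨hinj hc hx (Ne.symm hxc), hinj hc hy hyc, hinj hd hx (Ne.symm hxd), hinj hd hy hyd⟩

theorem isSwapDirection (ha : a ∈ U) (hb : b ∈ U) (hc : c ∈ U) (hd : d ∈ U)
    (h : HasDoubleSwap G (f a) (f b) (f c) (f d)) : IsSwapDirection G U f (a + b) := by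
  have h2 := two_eq_zero_vector
  have hcd : c + d = a + b := by
    linear_combination -(hf.add_eq hG hP hU ha hb hc hd (.inl h)) + c * h2
  have hab : a ≠ b := fun h' => h.1.1 (congrArg f h')
  refine ⟨fun h' => hab (by linear_combination h' - b * h2),
    fun x hx y hy z hz w hw hxy hzw hxz hxw => ?_⟩
  by_cases hxa : x = a
  · subst hxa
    obtain rfl := add_left_cancel hxy
    exact hf.hasDoubleSwap_of_add_eq ha hb hc hd hz hw h hcd hzw (Ne.symm hxz)
      fun h => hxw (by linear_combination h - hzw)
  by_cases hxb : x = b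
  · subst hxb
    obtain rfl : y = a := by linear_combination hxy
    exact (hf.hasDoubleSwap_of_add_eq ha hb hc hd hz hw h hcd hzw
      (fun h => hxw (by linear_combination h - hzw)) (Ne.symm hxz)).left
  have h3 := hf.hasDoubleSwap_of_add_eq ha hb hc hd hx hy h hcd hxy hxa hxb
  exact hf.hasDoubleSwap_of_add_eq hx hy ha hb hz hw h3.symm hxy.symm (hzw.trans hxy.symm)
    (Ne.symm hxz) fun h => hxw (by linear_combination h + hxy - hzw)

set_option synthInstance.maxSize 1000 in
set_option synthInstance.maxHeartbeats 200000 in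
-- Conjugating `(v, v+w)(v+u, v+u+w)` by `(v, v+u)(w, w+u)` gives `(v+u, v+w)(v, v+u+w)`, of
-- direction `u + w`.
theorem isSwapDirection_add {u w : Fin 3 → ZMod 2} (hu : IsSwapDirection G U f u)
    (hw : IsSwapDirection G U f w) (huw : u ≠ w) : IsSwapDirection G U f (u + w) := by
  have h2 := two_eq_zero_vector
  have key : ∀ u w : Fin 3 → ZMod 2, u ≠ 0 → w ≠ 0 → u ≠ w → ∃ v, v ≠ 0 ∧ v + u ≠ 0 ∧ v + w ≠ 0 ∧
      v + u + w ≠ 0 ∧ w + u ≠ 0 ∧ v ≠ w ∧ v ≠ w + u ∧ v ≠ v + u ∧ v ≠ v + u + w ∧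
      v + w ≠ v + u ∧ v + w ≠ w + u ∧ v + u + w ≠ v + u ∧ v + u + w ≠ w ∧
      v + u + w ≠ w + u := by
    decide +kernel
  obtain ⟨v, h3, h4, h5, h6, h7, h8, h9, h10, h11, h12, h13, h14, h15, h16⟩ :=
    key u w hu.1 hw.1 huw
  have h17 : v + w ≠ v := fun h => hw.1 (by linear_combination h)
  have h18 : v + w ≠ w := fun h => h3 (by linear_combination h)
  have m : ∀ {x}, x ≠ 0 → x ∈ U := fun h => hU.mem_of_ne h
  have hg := hu.2 v (m h3) (v + u) (m h4) w (m hw.1) (w + u) (m h7)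
    (by linear_combination v * h2) (by linear_combination w * h2) h8 h9
  have hh := hw.2 v (m h3) (v + w) (m h5) (v + u) (m h4) (v + u + w) (m h6)
    (by linear_combination v * h2) (by linear_combination (v + u) * h2) h10 h11
  have hinj : ∀ {x y}, x ≠ 0 → y ≠ 0 → x ≠ y → f x ≠ f y :=
    fun hx hy h h' => h (hf.1 (m hx) (m hy) h')
  have hc := hh.conj hg.2
  rw [hg.map₁, hg.map₂,
    hg.map_ne ⟨hinj h5 h3 h17, hinj h5 h4 h12, hinj h5 hw.1 h18, hinj h5 h7 h13⟩,
    hg.map_ne ⟨hinj h6 h3 h11.symm, hinj h6 h4 h14, hinj h6 hw.1 h15, hinj h6 h7 h16⟩] at hc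
  have hd := hf.isSwapDirection hG hP hU (m h4) (m h5) (m h3) (m h6) hc
  rwa [show v + u + (v + w) = u + w by linear_combination v * h2] at hd

/-- Swap directions together with `0` are closed under addition, so differing by one of them is an
equivalence relation; transitivity makes it universal. -/
theorem isSwapDirection_of_ne_zero (hgen : IsDoubleSwapGenerated G)
    [MulAction.IsPretransitive G Ω] (hs : f '' U = Set.univ) {u : Fin 3 → ZMod 2} (hu : u ≠ 0) :
    IsSwapDirection G U f u := by
  have h2 := two_eq_zero_vector
  have hs' : ∀ x, ∃ v ∈ U, f v = x := fun x => hs.ge (Set.mem_univ x)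
  choose g hgU hg using hs'
  have hgf : ∀ {v}, v ∈ U → g (f v) = v := fun hv => hf.1 (hgU _) hv (hg _)
  let r : Setoid Ω :=
    { r := fun x y => g x = g y ∨ IsSwapDirection G U f (g x + g y)
      iseqv :=
        { refl := fun _ => .inl rfl
          symm := by
            rintro x y (h | h)
            · exact .inl h.symm
            · exact .inr (add_comm (g x) _ ▸ h)
          trans := by
            rintro x y z (h | h) (h' | h')
            · exact .inl (h.trans h')
            · exact .inr (h ▸ h')
            · exact .inr (h' ▸ h)
            · by_cases hxz : g x = g z
              · exact .inl hxz
              · have := hf.isSwapDirection_add hG hP hU h h' fun h => hxz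
                  (by linear_combination h)
                rw [show g x + g y + (g y + g z) = g x + g z by
                  linear_combination g y * h2] at this
                exact .inr this } }
  have hr : ∀ x y, r x y := hgen.rel r fun a b c d h => by
    refine .inr (hf.isSwapDirection hG hP hU (hgU a) (hgU b) (hgU c) (hgU d) ?_)
    simpa only [hg] using h
  have key : ∀ u : Fin 3 → ZMod 2, u ≠ 0 → ∃ a, a ≠ 0 ∧ a + u ≠ 0 := by decide +kernel
  obtain ⟨a, ha, hau⟩ := key u hu
  rcases hr (f a) (f (a + u)) with h | h <;>
    rw [hgf (hU.mem_of_ne ha), hgf (hU.mem_of_ne hau)] at h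
  · exact absurd (by linear_combination -h) hu
  · rwa [show a + (a + u) = u by linear_combination a * h2] at h

end IsAffineConfiguration
end Direction
-- Double transpositions as transvections
section Matrices

open Matrix

set_option synthInstance.maxSize 1000 in
set_option synthInstance.maxHeartbeats 200000 in
/-- The double transposition of an affine plane that acts on it as a translation is an affine map;
it is linear if the plane does not contain the origin. -/
theorem exists_mulVec_add_eq_ite {a b c : Fin 3 → ZMod 2} (hab : a ≠ b) (hac : a ≠ c)
    (hbc : b ≠ c) : ∃ (A : SpecialLinearGroup (Fin 3) (ZMod 2)) (t : Fin 3 → ZMod 2),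
      (∀ x, A.1 *ᵥ x + t = if x = a then b else if x = b then a else if x = c then a + b + c else
        if x = a + b + c then c else x) ∧
      (a ≠ 0 → b ≠ 0 → c ≠ 0 → a + b + c ≠ 0 → t = 0) := by
  -- The cross product is a functional `φ` vanishing on the directions of the plane, so `φ x + φ a +
  -- 1` is `1` exactly on the plane. The map adds `a + b` there. Its linear part has determinant one
  -- because `φ (a + b) = 0`.
  have key : ∀ a b c : Fin 3 → ZMod 2, a ≠ b → a ≠ c → b ≠ c →
      ∀ x, x + (crossProduct (a + b) (a + c) ⬝ᵥ x) • (a + b) +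
          (1 + crossProduct (a + b) (a + c) ⬝ᵥ a) • (a + b) =
        if x = a then b else if x = b then a else if x = c then a + b + c else
          if x = a + b + c then c else x := by
    decide +kernel
  have key' : ∀ a b c : Fin 3 → ZMod 2, a ≠ b → a ≠ c → b ≠ c → a ≠ 0 → b ≠ 0 → c ≠ 0 →
      a + b + c ≠ 0 → 1 + crossProduct (a + b) (a + c) ⬝ᵥ a = 0 := by
    decide +kernel
  have hdet : (1 + vecMulVec (a + b) (crossProduct (a + b) (a + c))).det = 1 := by
    rw [vecMulVec_eq Unit, det_one_add_replicateCol_mul_replicateRow, dotProduct_comm,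
      dot_self_cross, add_zero]
  refine ⟨⟨_, hdet⟩, (1 + crossProduct (a + b) (a + c) ⬝ᵥ a) • (a + b), fun x => ?_,
    fun h1 h2 h3 h4 => by rw [key' a b c hab hac hbc h1 h2 h3 h4, zero_smul]⟩
  rw [← key a b c hab hac hbc x, add_mulVec, one_mulVec, vecMulVec_mulVec, op_smul_eq_smul]

theorem exists_transvection_mulVec_eq_ite {i j : Fin 3} (hij : i ≠ j) :
    ∃ a b c d : Fin 3 → ZMod 2, (a ≠ 0 ∧ b ≠ 0 ∧ c ≠ 0 ∧ d ≠ 0) ∧ (a ≠ c ∧ a ≠ d) ∧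
      a + b = c + d ∧ a + b ≠ 0 ∧ ∀ x, transvection i j (1 : ZMod 2) *ᵥ x =
        if x = a then b else if x = b then a else if x = c then d else if x = d then c else x := by
  have key : ∀ i j : Fin 3, i ≠ j → ∃ k : Fin 3, ∀ a b c d : Fin 3 → ZMod 2,
      a = Pi.single j 1 → b = a + Pi.single i 1 → c = a + Pi.single k 1 →
      d = b + Pi.single k 1 → (a ≠ 0 ∧ b ≠ 0 ∧ c ≠ 0 ∧ d ≠ 0) ∧ (a ≠ c ∧ a ≠ d) ∧
      a + b = c + d ∧ a + b ≠ 0 ∧ ∀ x, transvection i j (1 : ZMod 2) *ᵥ x =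
        if x = a then b else if x = b then a else if x = c then d else if x = d then c else x := by
    intro i j hij
    -- The third index, because `0 + 1 + 2 = 0` in `Fin 3`. The transvection adds `eᵢ` to the four
    -- vectors whose `j`-th coordinate is `1`.
    refine ⟨-(i + j), ?_⟩
    rintro _ _ _ _ rfl rfl rfl rfl
    revert i j
    decide +kernel
  obtain ⟨k, hk⟩ := key i j hij
  exact ⟨_, _, _, _, hk _ _ _ _ rfl rfl rfl rfl⟩

variable {Ω : Type*} [DecidableEq Ω] {G : Subgroup (Perm Ω)}
  {f : (Fin 3 → ZMod 2) → Ω} {U : Set (Fin 3 → ZMod 2)}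

theorem IsPuncturedOrFull.mulVec_mem (hU : IsPuncturedOrFull U)
    {M : Matrix (Fin 3) (Fin 3) (ZMod 2)} (hM : M.det ≠ 0) {v : Fin 3 → ZMod 2} (hv : v ∈ U) :
    M *ᵥ v ∈ U := by
  rcases hU with rfl | rfl
  · exact fun h => hv (eq_zero_of_mulVec_eq_zero hM h)
  · trivial

namespace IsAffineConfiguration

theorem swap_mul_swap_apply (hf : IsAffineConfiguration G U f) {a b c d : Fin 3 → ZMod 2}
    (ha : a ∈ U) (hb : b ∈ U) (hc : c ∈ U) (hd : d ∈ U)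
    (h : HasDoubleSwap G (f a) (f b) (f c) (f d)) {x : Fin 3 → ZMod 2} (hx : x ∈ U) :
    (swap (f a) (f b) * swap (f c) (f d)) (f x) =
      f (if x = a then b else if x = b then a else if x = c then d else if x = d then c else x) := by
  rw [h.apply]
  simp only [hf.1.eq_iff hx ha, hf.1.eq_iff hx hb, hf.1.eq_iff hx hc, hf.1.eq_iff hx hd]
  split_ifs <;> rfl

variable (hG : NoThreeCycle G) (hP : NoPentagon G) (hf : IsAffineConfiguration G U f)
  (hU : IsPuncturedOrFull U) (hgen : IsDoubleSwapGenerated G) (hs : f '' U = Set.univ)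
  [MulAction.IsPretransitive G Ω]
include hG hP hf hU hgen hs

/-- Over `𝔽₂` an invertible diagonal matrix is the identity, so transvections generate; each is a
double transposition along a swap direction. -/
theorem exists_apply_eq_mulVec {M : Matrix (Fin 3) (Fin 3) (ZMod 2)} (hM : M.det ≠ 0) :
    ∃ σ ∈ G, ∀ v ∈ U, σ (f v) = f (M *ᵥ v) := by
  refine diagonal_transvection_induction_of_det_ne_zero
    (fun M => ∃ σ ∈ G, ∀ v ∈ U, σ (f v) = f (M *ᵥ v)) M hM (fun D hD => ?_) (fun t => ?_)
    fun A B hA hB hA' hB' => ?_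
  · have key : ∀ x : ZMod 2, x ≠ 0 → x = 1 := by decide
    have hD1 : D = fun _ => 1 := by
      rw [det_diagonal, Finset.prod_ne_zero_iff] at hD
      exact funext fun i => key _ (hD i (Finset.mem_univ i))
    exact ⟨1, G.one_mem, fun v _ => by simp [hD1]⟩
  · have key : ∀ x : ZMod 2, x = 0 ∨ x = 1 := by decide
    rcases key t.c with h | h
    · exact ⟨1, G.one_mem, fun v _ => by simp [TransvectionStruct.toMatrix, h]⟩
    · obtain ⟨a, b, c, d, ⟨ha, hb, hc, hd⟩, ⟨hac, had⟩, habcd, hab, hx⟩ :=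
        exists_transvection_mulVec_eq_ite t.hij
      have hD := (hf.isSwapDirection_of_ne_zero hG hP hU hgen hs hab).2 a (hU.mem_of_ne ha) b
        (hU.mem_of_ne hb) c (hU.mem_of_ne hc) d (hU.mem_of_ne hd) rfl habcd.symm hac had
      refine ⟨_, hD.2, fun v hv => ?_⟩
      rw [hf.swap_mul_swap_apply (hU.mem_of_ne ha) (hU.mem_of_ne hb) (hU.mem_of_ne hc)
        (hU.mem_of_ne hd) hD hv, TransvectionStruct.toMatrix, h, hx]
  · obtain ⟨σ, hσ, h⟩ := hA'
    obtain ⟨τ, hτ, h'⟩ := hB'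
    exact ⟨σ * τ, G.mul_mem hσ hτ, fun v hv => by
      rw [Perm.mul_apply, h' v hv, h _ (hU.mulVec_mem hB hv), mulVec_mulVec]⟩

omit hgen [MulAction.IsPretransitive G Ω] in
/-- The double transpositions in `G` are affine maps, and linear maps if the origin is not among
the points. -/
theorem exists_swap_mul_swap_eq {p q r s : Ω} (h : HasDoubleSwap G p q r s) :
    ∃ (A : SpecialLinearGroup (Fin 3) (ZMod 2)) (t : Fin 3 → ZMod 2),
      (U = {0}ᶜ → t = 0) ∧ ∀ v ∈ U, (swap p q * swap r s) (f v) = f (A.1 *ᵥ v + t) := by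
  obtain ⟨a, ha, rfl⟩ := hs.ge (Set.mem_univ p)
  obtain ⟨b, hb, rfl⟩ := hs.ge (Set.mem_univ q)
  obtain ⟨c, hc, rfl⟩ := hs.ge (Set.mem_univ r)
  obtain ⟨d, hd, rfl⟩ := hs.ge (Set.mem_univ s)
  obtain rfl := hf.add_eq hG hP hU ha hb hc hd (.inl h)
  have ne : ∀ {x y}, f x ≠ f y → x ≠ y := fun h h' => h (congrArg f h')
  obtain ⟨A, t, hA, ht⟩ := exists_mulVec_add_eq_ite (ne h.1.1) (ne h.1.2.1) (ne h.1.2.2.2.1)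
  refine ⟨A, t, fun hU' => ?_, fun v hv => ?_⟩
  · subst hU'
    exact ht ha hb hc hd
  · rw [hf.swap_mul_swap_apply ha hb hc hd h hv, hA]

end IsAffineConfiguration
end Matrices
-- Identification of `AGL₃(2)` and `PSL₃(2)`
section FanoAndAffine

open Matrix

theorem mem_affineGeneralLinear {d : ℕ} {K : Type*} [Field K] {σ : Perm (Fin d → K)} :
    σ ∈ affineGeneralLinear d K ↔ ∃ A : (Fin d → K) ≃ᵃ[K] (Fin d → K), ∀ x, σ x = A x := by
  constructor
  · rintro ⟨A, rfl⟩
    exact ⟨A, fun _ => rfl⟩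
  · rintro ⟨A, hA⟩
    exact ⟨A, Equiv.ext fun x => (hA x).symm⟩

variable {Ω : Type*} [DecidableEq Ω] {G : Subgroup (Perm Ω)} {f : (Fin 3 → ZMod 2) → Ω}

namespace IsAffineConfiguration

theorem isPermIso_affineGeneralLinear [Fintype Ω] [MulAction.IsPretransitive G Ω]
    (hG : NoThreeCycle G) (hP : NoPentagon G) (hgen : IsDoubleSwapGenerated G)
    (hf : IsAffineConfiguration G Set.univ f) (hs : f '' Set.univ = Set.univ) :
    Fintype.card Ω = 8 ∧ IsPermIso G (affineGeneralLinear 3 (ZMod 2)) := by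
  have hU : IsPuncturedOrFull (Set.univ : Set (Fin 3 → ZMod 2)) := .inr rfl
  let E : (Fin 3 → ZMod 2) ≃ Ω := Equiv.ofBijective f
    ⟨Set.injOn_univ.1 hf.1, Set.range_eq_univ.1 (Set.image_univ ▸ hs)⟩
  have hE : ∀ v, E v = f v := fun _ => rfl
  have happ : ∀ (σ : Perm Ω) v, E.symm.permCongr σ v = E.symm (σ (f v)) := fun _ _ => rfl
  have hle : G ≤ (affineGeneralLinear 3 (ZMod 2)).comap E.symm.permCongrHom.toMonoidHom := by
    refine hgen.le fun p q r s h => ?_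
    obtain ⟨A, t, -, hA⟩ := hf.exists_swap_mul_swap_eq hG hP hU hs h
    have hA' : ∀ v, E.symm.permCongr (swap p q * swap r s) v = A.1 *ᵥ v + t := by
      intro v
      rw [happ, hA v trivial, ← hE, E.symm_apply_apply]
    refine mem_affineGeneralLinear.2 ⟨AffineEquiv.mk' (E.symm.permCongr (swap p q * swap r s))
      (SpecialLinearGroup.toLin' A) 0 fun v => ?_, fun v => rfl⟩
    rw [hA', hA', SpecialLinearGroup.toLin'_apply, vsub_eq_sub, sub_zero, vadd_eq_add,
      mulVec_zero, zero_add, toLin'_apply]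
  refine ⟨?_, isPermIso_of_mem_iff E.symm fun σ => ⟨fun h => hle h, fun hσ => ?_⟩⟩
  · rw [← Fintype.card_congr E]
    simp [ZMod.card]
  -- Transitivity supplies the translation part: `τ⁻¹ * σ` fixes the origin, so it is linear.
  obtain ⟨⟨τ, hτ⟩, h0⟩ := MulAction.exists_smul_eq G (f 0) (σ (f 0))
  have h0' : τ (f 0) = σ (f 0) := h0
  have h1 : E.symm.permCongr (τ⁻¹ * σ) ∈ affineGeneralLinear 3 (ZMod 2) := by
    have h2 : E.symm.permCongr (τ⁻¹ * σ) = E.symm.permCongr τ⁻¹ * E.symm.permCongr σ :=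
      map_mul E.symm.permCongrHom _ _
    rw [h2]
    exact Subgroup.mul_mem _ (hle (G.inv_mem hτ)) hσ
  obtain ⟨A, hA⟩ := mem_affineGeneralLinear.1 h1
  have hA0 : A 0 = 0 := by
    rw [← hA, happ, Perm.mul_apply, ← h0', Perm.inv_def, Equiv.symm_apply_apply, ← hE, E.symm_apply_apply]
  have hlin : ∀ v, A v = A.linear v := by
    intro v
    simpa [hA0] using A.map_vadd 0 v
  have hdet : (LinearMap.toMatrix' (A.linear : (Fin 3 → ZMod 2) →ₗ[ZMod 2] _)).det ≠ 0 := by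
    rw [LinearMap.det_toMatrix']
    exact A.linear.isUnit_det'.ne_zero
  obtain ⟨ρ, hρ, h3⟩ := hf.exists_apply_eq_mulVec hG hP hU hgen hs hdet
  have h4 : τ⁻¹ * σ = ρ := by
    refine Equiv.ext fun x => ?_
    obtain ⟨v, rfl⟩ := E.surjective x
    rw [hE, h3 v trivial, LinearMap.toMatrix'_mulVec, LinearEquiv.coe_coe, ← hlin, ← hA, happ,
      ← hE (E.symm _), E.apply_symm_apply]
  rw [inv_mul_eq_iff_eq_mul.1 h4]
  exact G.mul_mem hτ hρ

theorem isPermIso_projSpecialLinear [Fintype Ω] [MulAction.IsPretransitive G Ω]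
    (hG : NoThreeCycle G) (hP : NoPentagon G) (hgen : IsDoubleSwapGenerated G)
    (hf : IsAffineConfiguration G {0}ᶜ f) (hs : f '' {0}ᶜ = Set.univ) :
    Fintype.card Ω = 7 ∧ IsPermIso G (projSpecialLinear 3 (ZMod 2)) := by
  have hU : IsPuncturedOrFull ({0}ᶜ : Set (Fin 3 → ZMod 2)) := .inl rfl
  have hbij : Function.Bijective fun v : {v : Fin 3 → ZMod 2 // v ≠ 0} => f v := by
    refine ⟨fun v w h => Subtype.ext (hf.1 v.2 w.2 h), fun x => ?_⟩
    obtain ⟨v, hv, rfl⟩ := hs.ge (Set.mem_univ x)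
    exact ⟨⟨v, hv⟩, rfl⟩
  -- The only nonzero scalar is `1`, so projective points are nonzero vectors.
  have hbij' : Function.Bijective fun v : {v : Fin 3 → ZMod 2 // v ≠ 0} =>
      Projectivization.mk (ZMod 2) v.1 v.2 := by
    refine ⟨fun v w h => ?_, fun x => ?_⟩
    · have key : ∀ x : ZMod 2, x = 0 ∨ x = 1 := by decide
      obtain ⟨a, ha⟩ := (Projectivization.mk_eq_mk_iff' _ _ _ _ _).1 h
      rcases key a with rfl | rfl
      · exact absurd (by simpa using ha.symm) v.2
      · exact Subtype.ext (by simpa using ha.symm)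
    · induction x using Projectivization.ind with
      | h v hv => exact ⟨⟨v, hv⟩, rfl⟩
  let E := Equiv.ofBijective _ hbij
  let P := Equiv.ofBijective _ hbij'
  have hsmul : ∀ (σ : Perm Ω) (A : SpecialLinearGroup (Fin 3) (ZMod 2)),
      (∀ x, (E.symm.trans P).permCongr σ x = A • x) ↔ ∀ v ≠ 0, σ (f v) = f (A.1 *ᵥ v) := by
    intro σ A
    have hAv : ∀ v, v ≠ 0 → A.1 *ᵥ v ≠ 0 := fun v hv =>
      hU.mulVec_mem (by rw [A.2]; exact one_ne_zero) hv
    have h1 : ∀ v : {v : Fin 3 → ZMod 2 // v ≠ 0},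
        (E.symm.trans P).permCongr σ (P v) = P (E.symm (σ (f v))) := by
      intro v
      simp only [Equiv.permCongr_apply, Equiv.symm_trans_apply, Equiv.trans_apply,
        Equiv.symm_symm, Equiv.symm_apply_apply]
      rfl
    have h2 : ∀ v : {v : Fin 3 → ZMod 2 // v ≠ 0}, A • P v = P ⟨A.1 *ᵥ v, hAv v v.2⟩ :=
      fun v => rfl
    have h3 : ∀ v : {v : Fin 3 → ZMod 2 // v ≠ 0},
        f (A.1 *ᵥ v) = E ⟨A.1 *ᵥ v, hAv v v.2⟩ := fun v => rfl
    constructor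
    · intro h v hv
      have h4 := h (P ⟨v, hv⟩)
      rw [h1, h2, P.apply_eq_iff_eq, Equiv.symm_apply_eq] at h4
      exact h4
    · intro h x
      obtain ⟨v, rfl⟩ := P.surjective x
      rw [h1, h2, P.apply_eq_iff_eq, Equiv.symm_apply_eq]
      exact h v v.2
  have hle : G ≤ (projSpecialLinear 3 (ZMod 2)).comap
      (E.symm.trans P).permCongrHom.toMonoidHom := by
    refine hgen.le fun p q r s h => mem_projSpecialLinear.2 ?_
    obtain ⟨A, t, ht, hA⟩ := hf.exists_swap_mul_swap_eq hG hP hU hs h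
    refine ⟨A, (hsmul _ A).2 fun v hv => ?_⟩
    rw [hA v hv, ht rfl, add_zero]
  refine ⟨?_, isPermIso_of_mem_iff (E.symm.trans P) fun σ => ⟨fun h => hle h, fun hσ => ?_⟩⟩
  · rw [← Fintype.card_congr E]
    decide +kernel
  obtain ⟨A, hA⟩ := mem_projSpecialLinear.1 hσ
  obtain ⟨τ, hτ, h⟩ := hf.exists_apply_eq_mulVec hG hP hU hgen hs (M := A.1)
    (by rw [A.2]; exact one_ne_zero)
  have h1 : σ = τ := by
    refine Equiv.ext fun x => ?_
    obtain ⟨v, hv, rfl⟩ := hs.ge (Set.mem_univ x)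
    rw [h v hv, (hsmul σ A).1 hA v hv]
  exact h1 ▸ hτ

end IsAffineConfiguration
end FanoAndAffine

/-! ### The primitive case and the conclusion -/

section Preprimitive

variable {Ω : Type*} [DecidableEq Ω] [Fintype Ω] {G : Subgroup (Perm Ω)}

theorem classification_of_isPreprimitive [MulAction.IsPreprimitive G Ω] [Nontrivial Ω]
    (hgi : generatorIndex G ≤ 2) :
    (G = alternatingGroup Ω ∨ G = ⊤) ∨
      (Fintype.card Ω = 5 ∧ IsPermIso G (dihedral 5)) ∨
      (Fintype.card Ω = 6 ∧ IsPermIso G (projSpecialLinear 2 (ZMod 5))) ∨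
      (Fintype.card Ω = 7 ∧ IsPermIso G (projSpecialLinear 3 (ZMod 2))) ∨
      (Fintype.card Ω = 8 ∧ IsPermIso G (affineGeneralLinear 3 (ZMod 2))) := by
  by_cases hswap : ∃ σ ∈ G, σ.IsSwap
  · obtain ⟨σ, hσ, h⟩ := hswap
    exact .inl (.inr (Perm.subgroup_eq_top_of_isPreprimitive_of_isSwap_mem inferInstance _ h hσ))
  by_cases hthree : ∃ σ ∈ G, σ.IsThreeCycle
  · obtain ⟨σ, hσ, h⟩ := hthree
    have h1 := Perm.alternatingGroup_le_of_isPreprimitive_of_isThreeCycle_mem inferInstance h hσ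
    -- If `G` is larger than the alternating group it contains an odd `ρ`, and every odd `τ` is `(τ
    -- * ρ) * ρ⁻¹`.
    refine .inl (or_iff_not_imp_left.2 fun h2 => eq_top_iff.2 fun τ _ => ?_)
    obtain ⟨ρ, hρ, hρ'⟩ := SetLike.exists_of_lt (lt_of_le_of_ne h1 (Ne.symm h2))
    rcases Int.units_eq_one_or (Perm.sign τ) with h3 | h3
    · exact h1 h3
    · have h4 : Perm.sign ρ = -1 := (Int.units_eq_one_or _).resolve_left hρ'
      have h5 : τ * ρ ∈ alternatingGroup Ω := by
        rw [Perm.mem_alternatingGroup, map_mul, h3, h4]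
        decide
      simpa using G.mul_mem (h1 h5) (G.inv_mem hρ)
  have hG : NoThreeCycle G := fun a b c hab hac hbc h =>
    hthree ⟨_, h, Perm.isThreeCycle_swap_mul_swap_same hab hac hbc⟩
  have hgen : IsDoubleSwapGenerated G := by
    obtain ⟨S, hS, hS'⟩ := exists_generating_set hgi
    have hSG : ∀ σ ∈ S, σ ∈ G := fun σ hσ => hS ▸ Subgroup.subset_closure hσ
    refine ⟨S, hS, fun σ hσ => ?_⟩
    rcases cases_of_ind_le_two (hS' σ hσ) with h | h | h | ⟨a, b, c, d, hn, rfl⟩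
    · exact .inl h
    · exact absurd ⟨σ, hSG σ hσ, h⟩ hswap
    · exact absurd ⟨σ, hSG σ hσ, h⟩ hthree
    · exact .inr ⟨a, b, c, d, ⟨hn, hSG _ hσ⟩, rfl⟩
  refine .inr ?_
  by_cases hP : NoPentagon G
  · obtain ⟨f, hf⟩ := exists_isAffineConfiguration_of_isPreprimitive hG hP hgen
    rcases hf.exists_surjOn hG hP hgen rfl with hs | ⟨g, hg, hs⟩
    · exact .inr (.inr (.inl (hf.isPermIso_projSpecialLinear hG hP hgen hs)))
    · exact .inr (.inr (.inr (hg.isPermIso_affineGeneralLinear hG hP hgen hs)))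
  · simp only [NoPentagon, not_forall] at hP
    obtain ⟨a, b, c, d, e, h, h', hde⟩ := hP
    obtain ⟨f, hf⟩ := exists_isPentagon h h' hde
    rcases hf.classification hG hgen with h | h
    · exact .inl h
    · exact .inr (.inl h)

end Preprimitive
end PermGroup

theorem proposition2p3 (n : ℕ) (G : Subgroup (Equiv.Perm (Fin n)))
    (htrans : MulAction.IsPretransitive G (Fin n))
    (hgi : PermGroup.generatorIndex G ≤ 2) :
    (G = alternatingGroup (Fin n) ∨ G = ⊤) ∨
    (∃ m : ℕ, n = 2 * m ∧ PermGroup.IsPermIso G (PermGroup.c2WreathSym m)) ∨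
    (∃ m : ℕ, n = 2 * m ∧
      PermGroup.IsPermIso G (PermGroup.c2WreathSym m ⊓ alternatingGroup (Fin m × Fin 2))) ∨
    ((n = 5 ∧ PermGroup.IsPermIso G (PermGroup.dihedral 5)) ∨
      (n = 6 ∧ PermGroup.IsPermIso G (PermGroup.projSpecialLinear 2 (ZMod 5))) ∨
      (n = 7 ∧ PermGroup.IsPermIso G (PermGroup.projSpecialLinear 3 (ZMod 2))) ∨
      (n = 8 ∧ PermGroup.IsPermIso G (PermGroup.affineGeneralLinear 3 (ZMod 2)))) := by
  rcases subsingleton_or_nontrivial (Fin n) with hn | hn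
  -- On at most one point the symmetric group is trivial.
  · exact .inl (.inr (Subsingleton.elim _ _))
  by_cases hprim : MulAction.IsPreprimitive G (Fin n)
  · have h := PermGroup.classification_of_isPreprimitive hgi
    rw [Fintype.card_fin] at h
    exact h.imp_right fun h => .inr (.inr h)
  · obtain ⟨m, hm, h | h⟩ := PermGroup.isPermIso_of_not_isPreprimitive hgi hprim
    · exact .inr (.inl ⟨m, Fintype.card_fin n ▸ hm, h⟩)
    · exact .inr (.inr (.inl ⟨m, Fintype.card_fin n ▸ hm, h⟩))
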